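/- **Lemma.** For $A,B\in\mathbb R^{d_1\times d_2}$ let $\langle A,B\rangle=\sum_{j,k}A_{jk}B_{jk}$, and let $\|\cdot\|_F$ and $\|\cdot\|_{\rm op}$ be the Frobenius and operator (largest singular value) norms; put $d=\max\{d_1,d_2\}$. Let $c(\sigma)>0$, let $\nu$ be a $\sigma$-finite measure on $\mathbb R$, and let $\psi:\mathbb R\to\mathbb R$ be a convex, twice continuously differentiable function that is the log partition function of the exponential family with base measure $\nu$ and noise level $c(\sigma)$, i.e. $\int \exp\{(y\theta-\psi(\theta))/c(\sigma)\}\,\nu(dy)=1$ for every $\theta\in\mathbb R$. (For matrix sensing with noise $N(0,\sigma^2)$: $\psi(\theta)=\theta^2/2$, $c(\sigma)=\sigma^2$, $\nu=N(0,\sigma^2)$. For one-bit matrix sensing: $\psi(\theta)=\log(1+e^\theta)$, $c(\sigma)=1$, $\nu=\delta_0+\delta_1$.) Let $X^\natural\in\mathbb R^{d_1\times d_2}$ have rank $r^\natural\ge 1$, and let $(A_i,y_i)$, $i=1,\dots,n$, be independent pairs such that $A_i\in\mathbb R^{d_1\times d_2}$ has i.i.d. standard Gaussian entries and, given $A_i$,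 the response $y_i$ has density $\exp\{(y\langle A_i,X^\natural\rangle-\psi(\langle A_i,X^\natural\rangle))/c(\sigma)\}$ with respect to $\nu$. Let $$\mathcal L(X)=\frac1n\sum_{i=1}^n\bigl(\psi(\langle A_i,X\rangle)-y_i\langle A_i,X\rangle\bigr).$$ For $\mathcal C\subseteq\mathbb R^{d_1\times d_2}$, say that $\mathcal L$ satisfies $(r,\alpha,\mathcal C)$-RSC, respectively $(r,\beta,\mathcal C)$-RSM, if for all $X,Y\in\mathcal C$ of rank at most $r$ $$\frac{\alpha}{2}\|X-Y\|_F^2\le \mathcal L(Y)-\mathcal L(X)-\langle\nabla\mathcal L(X),Y-X\rangle,\quad\text{respectively}\quad \mathcal L(Y)-\mathcal L(X)-\langle\nabla\mathcal L(X),Y-X\rangle\le\frac{\beta}{2}\|X-Y\|_F^2 .$$ There are universal constants $c,C,c_0,c_1>0$ such that the following holds in every such setting. Let $\tau\ge1$, let $\mathcal C=\{X:\|X\|_F\le\tau\|X^\natural\|_F\}$, and let $$\overline B=\sup_{x\in\mathbb R}|\psi''(x)|,\qquad \underline B=\inf_{|x|\le\sqrt{2.4/c_0}\,\tau\|X^\natural\|_F}\psi''(x),\qquad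 \kappa=1.1\,\overline B/\underline B,\qquad t_0=\lceil4\kappa(\log(4\kappa)+1)\rceil ,$$ where it is assumed that $\overline B<\infty$ and $\underline B>0$. If $n\ge c\,(\lceil\kappa\log\kappa\rceil+1)\,r^\natural d$, then with probability at least $1-\exp(-c_1d)$ the following hold simultaneously: * $\mathcal L$ satisfies $(t_0r^\natural,\tfrac{15}{16}\underline B,\mathcal C)$-RSC and $(t_0r^\natural,\tfrac{17}{16}\overline B,\mathcal C)$-RSM; * $\|\nabla\mathcal L(X^\natural)\|_{\rm op}\le C\sqrt{c(\sigma)\overline B}\,\sqrt{d/n}$. -/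

import Mathlib

open MeasureTheory ProbabilityTheory

noncomputable section

namespace RGLM

/-- The trace inner product `⟨A, B⟩ = ∑ᵢⱼ Aᵢⱼ Bᵢⱼ`. -/
def frobInner {d₁ d₂ : ℕ} (A B : Matrix (Fin d₁) (Fin d₂) ℝ) : ℝ :=
  ∑ j, ∑ k, A j k * B j k

/-- The Frobenius norm. -/
def frobNorm {d₁ d₂ : ℕ} (X : Matrix (Fin d₁) (Fin d₂) ℝ) : ℝ :=
  letI : NormedAddCommGroup (Matrix (Fin d₁) (Fin d₂) ℝ) := Matrix.frobeniusNormedAddCommGroup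
  ‖X‖

/-- The operator norm (largest singular value), i.e. the norm of `X` as a linear map between
Euclidean spaces. -/
def opNorm {d₁ d₂ : ℕ} (X : Matrix (Fin d₁) (Fin d₂) ℝ) : ℝ :=
  letI : NormedAddCommGroup (Matrix (Fin d₁) (Fin d₂) ℝ) := Matrix.instL2OpNormedAddCommGroup
  ‖X‖

/-- The closed Frobenius norm ball of radius `ξ` centred at the origin. -/
def frobBall (d₁ d₂ : ℕ) (ξ : ℝ) : Set (Matrix (Fin d₁) (Fin d₂) ℝ) :=
  {X | frobNorm X ≤ ξ}

/-- The gradient of `f` with respect to the trace inner product: the matrix of partial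
derivatives of `f`. -/
def grad {d₁ d₂ : ℕ} (f : Matrix (Fin d₁) (Fin d₂) ℝ → ℝ) (X : Matrix (Fin d₁) (Fin d₂) ℝ) :
    Matrix (Fin d₁) (Fin d₂) ℝ :=
  Matrix.of fun j k => deriv (fun t : ℝ => f (X + t • Matrix.single j k 1)) 0

/-- `(r, α, 𝒞)`-restricted strong convexity of `f`. -/
def RSC {d₁ d₂ : ℕ} (f : Matrix (Fin d₁) (Fin d₂) ℝ → ℝ) (r : ℕ) (α : ℝ)
    (𝒞 : Set (Matrix (Fin d₁) (Fin d₂) ℝ)) : Prop :=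
  ∀ X ∈ 𝒞, ∀ Y ∈ 𝒞, X.rank ≤ r → Y.rank ≤ r →
    α / 2 * frobNorm (X - Y) ^ 2 ≤ f Y - f X - frobInner (grad f X) (Y - X)

/-- `(r, β, 𝒞)`-restricted smoothness of `f`. -/
def RSM {d₁ d₂ : ℕ} (f : Matrix (Fin d₁) (Fin d₂) ℝ → ℝ) (r : ℕ) (β : ℝ)
    (𝒞 : Set (Matrix (Fin d₁) (Fin d₂) ℝ)) : Prop :=
  ∀ X ∈ 𝒞, ∀ Y ∈ 𝒞, X.rank ≤ r → Y.rank ≤ r →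
    f Y - f X - frobInner (grad f X) (Y - X) ≤ β / 2 * frobNorm (X - Y) ^ 2

/-- The negative log-likelihood
`𝓛(X) = n⁻¹ ∑ᵢ (ψ(⟨Aᵢ, X⟩) - yᵢ ⟨Aᵢ, X⟩)` of the data `(Aᵢ, yᵢ)`, `i = 1, …, n`. -/
def loss {d₁ d₂ n : ℕ} (ψ : ℝ → ℝ) (A : Fin n → Matrix (Fin d₁) (Fin d₂) ℝ) (y : Fin n → ℝ)
    (X : Matrix (Fin d₁) (Fin d₂) ℝ) : ℝ :=
  (1 / (n : ℝ)) * ∑ i, (ψ (frobInner (A i) X) - y i * frobInner (A i) X)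

/-- The density at `y`, with respect to the base measure, of the exponential family distribution
with natural parameter `θ`, log partition function `ψ` and noise level `s`. -/
def glmDensity (ψ : ℝ → ℝ) (s θ y : ℝ) : ENNReal :=
  ENNReal.ofReal (Real.exp ((y * θ - ψ θ) / s))

/-- `ψ` is a convex, twice continuously differentiable log partition function of the exponential
family with base measure `ν` and noise level `s`: for every natural parameter the density
`glmDensity` is normalized. -/
structure IsLogPartition (ν : Measure ℝ) (ψ : ℝ → ℝ) (s : ℝ) : Prop where
  convexOn : ConvexOn ℝ Set.univ ψ
  contDiff : ContDiff ℝ 2 ψ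
  normalized : ∀ θ : ℝ, ∫⁻ y, glmDensity ψ s θ y ∂ν = 1

/-- Matrices carry the product (equivalently, Borel) σ-algebra of their entries. -/
instance instMeasurableSpaceMatrix {d₁ d₂ : ℕ} : MeasurableSpace (Matrix (Fin d₁) (Fin d₂) ℝ) :=
  inferInstanceAs (MeasurableSpace (Fin d₁ → Fin d₂ → ℝ))

/-- The law of a random `d₁ × d₂` matrix with i.i.d. standard Gaussian entries. -/
def gaussianMatrix (d₁ d₂ : ℕ) : Measure (Matrix (Fin d₁) (Fin d₂) ℝ) :=
  (Measure.pi fun _ : Fin d₁ => Measure.pi fun _ : Fin d₂ => gaussianReal 0 1 :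
    Measure (Fin d₁ → Fin d₂ → ℝ))

/-- The joint law of a pair `(A, y)` for which `A` is a standard Gaussian matrix and, given `A`,
the response `y` has the exponential family density with natural parameter `⟨A, X⟩` with respect
to `ν`. -/
def pairLaw {d₁ d₂ : ℕ} (ν : Measure ℝ) (ψ : ℝ → ℝ) (s : ℝ)
    (X : Matrix (Fin d₁) (Fin d₂) ℝ) : Measure (Matrix (Fin d₁) (Fin d₂) ℝ × ℝ) :=
  ((gaussianMatrix d₁ d₂).prod ν).withDensity fun p => glmDensity ψ s (frobInner p.1 X) p.2

/-- The rank-constrained generalized linear model with Gaussian measurements and ground truth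
`X`: the pairs `(Aᵢ, yᵢ)` are independent and each has the law `pairLaw`. -/
structure IsGaussianModel {Ω : Type*} [MeasurableSpace Ω] (P : Measure Ω) {d₁ d₂ n : ℕ}
    (ν : Measure ℝ) (ψ : ℝ → ℝ) (s : ℝ) (X : Matrix (Fin d₁) (Fin d₂) ℝ)
    (A : Fin n → Ω → Matrix (Fin d₁) (Fin d₂) ℝ) (y : Fin n → Ω → ℝ) : Prop where
  indep : iIndepFun (fun i ω => (A i ω, y i ω)) P
  law : ∀ i, HasLaw (fun ω => (A i ω, y i ω)) (pairLaw ν ψ s X) P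

/-- `B̄ = sup_{x ∈ ℝ} |ψ''(x)|` (meaningful when `ψ''` is bounded). -/
def Bupper (ψ : ℝ → ℝ) : ℝ := ⨆ x : ℝ, |iteratedDeriv 2 ψ x|

/-- `B̲ = inf_{|x| ≤ M} ψ''(x)`. -/
def Blower (ψ : ℝ → ℝ) (M : ℝ) : ℝ := sInf (iteratedDeriv 2 ψ '' {x : ℝ | |x| ≤ M})

end RGLM

end

/-! The Bregman remainder of the loss at `X`, `Y` is the average of the scalar Taylor remainders of
`ψ` between `⟨Aᵢ, X⟩` and `⟨Aᵢ, Y⟩`. Each remainder lies between half of the bounds on `ψ''` times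
`⟨Aᵢ, Y - X⟩ ^ 2`, so smoothness and convexity reduce to restricted isometry for a Gaussian
ensemble.

Smoothness needs only the upper isometry bound, since `Bup` bounds `ψ''` everywhere. For convexity,
`Blow` is available only when both `⟨Aᵢ, X⟩` and `⟨Aᵢ, Y⟩` lie in `[-M, M]`. By Markov counting and
the upper isometry bound, only a small fraction of indices `J` violates this. Their terms are
nonnegative by convexity of `ψ` and are dropped. No small set of indices carries much of `∑ ⟨Aᵢ, Z⟩
^ 2`: the part below a level `T` is bounded by `T ^ 2` per index, and the part above `T` is
uniformly small (`IsRegularOn.le_sum_compl_sq`).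

Uniformity over low rank comes from a net of products `Q * B`, of size exponential in `k * d`
(`exists_isRankNet`). On it three Chernoff bounds are imposed: upper and lower quadratic sums, and
the soft-thresholded sum. They are then transferred off the net by subadditivity or Lipschitz
perturbation.

The gradient at the truth is an average of centred responses times `Aᵢ`. Exponential tilting makes
the centred response sub-Gaussian with variance proxy `s * Bup`. The same Chernoff and net argument,
on rank-one matrices, bounds the operator norm. -/

namespace RGLM

/-! ### Volumetric nets of unit balls. -/

section Nets

/-- Volume comparison: the balls of radius `ε / 2` about the points are disjoint and fit in the ball
of radius `1 + ε / 2`. -/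
theorem card_le_of_separated {E : Type*} [NormedAddCommGroup E] [NormedSpace ℝ E]
    [FiniteDimensional ℝ E] {ε : ℝ} (hε : 0 < ε) (S : Finset E) (hS : ∀ x ∈ S, ‖x‖ ≤ 1)
    (hsep : ∀ x ∈ S, ∀ y ∈ S, x ≠ y → ε < ‖x - y‖) :
    (S.card : ℝ) ≤ (1 + 2 / ε) ^ Module.finrank ℝ E := by
  let _ : MeasurableSpace E := borel E
  have : BorelSpace E := ⟨rfl⟩
  let μ : Measure E := Measure.addHaar
  set D := Module.finrank ℝ E
  have hball : ∀ x : E, ∀ r : ℝ, 0 < r →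
      μ.real (Metric.ball x r) = r ^ D * μ.real (Metric.ball 0 1) := by
    intro x r hr
    rw [Measure.real, Measure.addHaar_ball_of_pos μ x hr, ENNReal.toReal_mul,
      ENNReal.toReal_ofReal (by positivity)]
    rfl
  have hpos : 0 < μ.real (Metric.ball (0 : E) 1) :=
    ENNReal.toReal_pos (Metric.measure_ball_pos μ 0 one_pos).ne' measure_ball_lt_top.ne
  have hdisj : (S : Set E).PairwiseDisjoint fun x => Metric.ball x (ε / 2) := by
    intro x hx y hy hxy
    refine Metric.ball_disjoint_ball ?_
    rw [dist_eq_norm]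
    linarith [hsep x hx y hy hxy]
  have hsub : (⋃ x ∈ S, Metric.ball x (ε / 2)) ⊆ Metric.ball (0 : E) (1 + ε / 2) := by
    intro z hz
    simp only [Set.mem_iUnion, Metric.mem_ball, exists_prop] at hz
    obtain ⟨x, hx, hzx⟩ := hz
    have h1 := hS x hx
    have h2 : ‖z‖ ≤ ‖z - x‖ + ‖x‖ := by simpa using norm_add_le (z - x) x
    rw [dist_eq_norm] at hzx
    rw [mem_ball_zero_iff]
    linarith
  have h1 : (S.card : ℝ) * ((ε / 2) ^ D * μ.real (Metric.ball 0 1)) ≤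
      (1 + ε / 2) ^ D * μ.real (Metric.ball 0 1) := by
    calc (S.card : ℝ) * ((ε / 2) ^ D * μ.real (Metric.ball 0 1))
        = ∑ x ∈ S, μ.real (Metric.ball x (ε / 2)) := by
          simp [hball _ (ε / 2) (by positivity)]
      _ = μ.real (⋃ x ∈ S, Metric.ball x (ε / 2)) := by
          rw [measureReal_biUnion_finset hdisj (fun _ _ => measurableSet_ball)
            (fun _ _ => measure_ball_lt_top.ne)]
      _ ≤ μ.real (Metric.ball (0 : E) (1 + ε / 2)) :=
          measureReal_mono hsub measure_ball_lt_top.ne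
      _ = _ := hball _ _ (by positivity)
  have h2 : (S.card : ℝ) * (ε / 2) ^ D ≤ (1 + ε / 2) ^ D := by
    rw [← mul_assoc] at h1
    exact le_of_mul_le_mul_right h1 hpos
  have h3 : (1 + 2 / ε) ^ D = (1 + ε / 2) ^ D / (ε / 2) ^ D := by
    rw [← div_pow]
    congr 1
    field_simp
    ring
  rw [h3, le_div_iff₀ (by positivity)]
  exact h2

/-- A separated set of maximal cardinality is a net, since any uncovered point could be added to it.
-/
theorem exists_finset_net (E : Type*) [NormedAddCommGroup E] [NormedSpace ℝ E]
    [FiniteDimensional ℝ E] {ε : ℝ} (hε : 0 < ε) :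
    ∃ N : Finset E, (∀ x ∈ N, ‖x‖ ≤ 1) ∧ (∀ x, ‖x‖ ≤ 1 → ∃ y ∈ N, ‖x - y‖ ≤ ε) ∧
      (N.card : ℝ) ≤ (1 + 2 / ε) ^ Module.finrank ℝ E := by
  classical
  let Q : Set ℕ := {m | ∃ S : Finset E, (∀ x ∈ S, ‖x‖ ≤ 1) ∧
    (∀ x ∈ S, ∀ y ∈ S, x ≠ y → ε < ‖x - y‖) ∧ S.card = m}
  have hne : Q.Nonempty := ⟨0, ∅, by simp, by simp, rfl⟩
  have hbdd : BddAbove Q := by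
    refine ⟨⌈(1 + 2 / ε) ^ Module.finrank ℝ E⌉₊, ?_⟩
    rintro m ⟨S, h1, h2, rfl⟩
    exact_mod_cast (card_le_of_separated hε S h1 h2).trans (Nat.le_ceil _)
  obtain ⟨N, h1, h2, h3⟩ := Nat.sSup_mem hne hbdd
  refine ⟨N, h1, ?_, card_le_of_separated hε N h1 h2⟩
  intro x hx
  by_contra! hcon
  have hxN : x ∉ N := fun h => by
    have := hcon x h
    simp at this
    linarith
  have : (insert x N).card ∈ Q := by
    refine ⟨insert x N, ?_, ?_, rfl⟩
    · intro y hy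
      rcases Finset.mem_insert.1 hy with h | h
      · exact h ▸ hx
      · exact h1 y h
    · intro y hy z hz hyz
      rcases Finset.mem_insert.1 hy with h | h <;> rcases Finset.mem_insert.1 hz with h' | h'
      · exact absurd (h.trans h'.symm) hyz
      · exact h ▸ hcon z h'
      · rw [norm_sub_rev]
        exact h' ▸ hcon y h
      · exact h2 y h z h' hyz
  have hle := le_csSup hbdd this
  rw [Finset.card_insert_of_notMem hxN, h3] at hle
  omega

end Nets

/-! ### Frobenius and operator norms. -/

section MatrixNorms

variable {d₁ d₂ : ℕ}

theorem frobNorm_sq (X : Matrix (Fin d₁) (Fin d₂) ℝ) : frobNorm X ^ 2 = ∑ j, ∑ k, X j k ^ 2 := by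
  rw [frobNorm, Matrix.frobenius_norm_def, ← Real.sqrt_eq_rpow, Real.sq_sqrt (by positivity)]
  simp

theorem frobNorm_nonneg (X : Matrix (Fin d₁) (Fin d₂) ℝ) : 0 ≤ frobNorm X := by
  let _ : NormedAddCommGroup (Matrix (Fin d₁) (Fin d₂) ℝ) := Matrix.frobeniusNormedAddCommGroup
  exact norm_nonneg X

theorem frobNorm_smul (c : ℝ) (X : Matrix (Fin d₁) (Fin d₂) ℝ) :
    frobNorm (c • X) = |c| * frobNorm X := by
  let _ : NormedAddCommGroup (Matrix (Fin d₁) (Fin d₂) ℝ) := Matrix.frobeniusNormedAddCommGroup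
  let _ : NormedSpace ℝ (Matrix (Fin d₁) (Fin d₂) ℝ) := Matrix.frobeniusNormedSpace
  exact norm_smul c X

theorem frobNorm_add_le (X Y : Matrix (Fin d₁) (Fin d₂) ℝ) :
    frobNorm (X + Y) ≤ frobNorm X + frobNorm Y := by
  let _ : NormedAddCommGroup (Matrix (Fin d₁) (Fin d₂) ℝ) := Matrix.frobeniusNormedAddCommGroup
  exact norm_add_le X Y

theorem frobNorm_eq_zero {X : Matrix (Fin d₁) (Fin d₂) ℝ} : frobNorm X = 0 ↔ X = 0 := by
  let _ : NormedAddCommGroup (Matrix (Fin d₁) (Fin d₂) ℝ) := Matrix.frobeniusNormedAddCommGroup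
  exact norm_eq_zero (a := X)

theorem opNorm_nonneg (X : Matrix (Fin d₁) (Fin d₂) ℝ) : 0 ≤ opNorm X := by
  let _ : NormedAddCommGroup (Matrix (Fin d₁) (Fin d₂) ℝ) := Matrix.instL2OpNormedAddCommGroup
  exact norm_nonneg X

theorem sum_mulVec_sq_le (X : Matrix (Fin d₁) (Fin d₂) ℝ) (v : Fin d₂ → ℝ) :
    ∑ j, (X.mulVec v) j ^ 2 ≤ opNorm X ^ 2 * ∑ k, v k ^ 2 := by
  let _ : NormedAddCommGroup (Matrix (Fin d₁) (Fin d₂) ℝ) := Matrix.instL2OpNormedAddCommGroup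
  have h := Matrix.l2_opNorm_mulVec X (WithLp.toLp 2 v)
  have h2 := pow_le_pow_left₀ (norm_nonneg _) h 2
  rw [mul_pow, EuclideanSpace.real_norm_sq_eq, EuclideanSpace.real_norm_sq_eq] at h2
  exact h2

theorem opNorm_le_of_sum_mulVec_sq_le {X : Matrix (Fin d₁) (Fin d₂) ℝ} {M : ℝ} (hM : 0 ≤ M)
    (h : ∀ v : Fin d₂ → ℝ, ∑ j, (X.mulVec v) j ^ 2 ≤ M ^ 2 * ∑ k, v k ^ 2) : opNorm X ≤ M := by
  let _ : NormedAddCommGroup (Matrix (Fin d₁) (Fin d₂) ℝ) := Matrix.instL2OpNormedAddCommGroup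
  change ‖X‖ ≤ M
  rw [Matrix.l2_opNorm_def]
  refine ContinuousLinearMap.opNorm_le_bound _ hM fun x => ?_
  refine le_of_sq_le_sq ?_ (by positivity)
  rw [mul_pow, EuclideanSpace.real_norm_sq_eq, EuclideanSpace.real_norm_sq_eq]
  exact h x.ofLp

theorem frobNorm_mul_le {k : ℕ} (Q : Matrix (Fin d₁) (Fin k) ℝ) (B : Matrix (Fin k) (Fin d₂) ℝ) :
    frobNorm (Q * B) ≤ opNorm Q * frobNorm B := by
  refine le_of_sq_le_sq ?_ (mul_nonneg (opNorm_nonneg _) (frobNorm_nonneg _))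
  rw [mul_pow, frobNorm_sq, frobNorm_sq, Finset.sum_comm, Finset.sum_comm (γ := Fin k),
    Finset.mul_sum]
  refine Finset.sum_le_sum fun l _ => ?_
  exact sum_mulVec_sq_le Q fun i => B i l

theorem frobInner_add_right (A X Y : Matrix (Fin d₁) (Fin d₂) ℝ) :
    frobInner A (X + Y) = frobInner A X + frobInner A Y := by
  simp [frobInner, mul_add, Finset.sum_add_distrib]

theorem frobInner_smul_right (c : ℝ) (A X : Matrix (Fin d₁) (Fin d₂) ℝ) :
    frobInner A (c • X) = c * frobInner A X := by
  simp only [frobInner, Finset.mul_sum, Matrix.smul_apply, smul_eq_mul]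
  refine Finset.sum_congr rfl fun _ _ => Finset.sum_congr rfl fun _ _ => by ring

theorem frobInner_sub_right (A X Y : Matrix (Fin d₁) (Fin d₂) ℝ) :
    frobInner A (X - Y) = frobInner A X - frobInner A Y := by
  simp [frobInner, mul_sub, Finset.sum_sub_distrib]

theorem abs_frobInner_le (A X : Matrix (Fin d₁) (Fin d₂) ℝ) :
    |frobInner A X| ≤ frobNorm A * frobNorm X := by
  refine abs_le_of_sq_le_sq ?_ (mul_nonneg (frobNorm_nonneg _) (frobNorm_nonneg _))
  rw [mul_pow, frobNorm_sq, frobNorm_sq, frobInner]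
  simp_rw [← Finset.sum_product']
  exact Finset.sum_mul_sq_le_sq_mul_sq _ _ _

theorem frobInner_vecMulVec (M : Matrix (Fin d₁) (Fin d₂) ℝ) (u : Fin d₁ → ℝ) (v : Fin d₂ → ℝ) :
    frobInner M (Matrix.vecMulVec u v) = ∑ j, u j * M.mulVec v j := by
  simp only [frobInner, Matrix.vecMulVec_apply, Matrix.mulVec, dotProduct, Finset.mul_sum]
  refine Finset.sum_congr rfl fun _ _ => Finset.sum_congr rfl fun _ _ => by ring

theorem frobNorm_vecMulVec_sq (u : Fin d₁ → ℝ) (v : Fin d₂ → ℝ) :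
    frobNorm (Matrix.vecMulVec u v) ^ 2 = (∑ j, u j ^ 2) * ∑ k, v k ^ 2 := by
  rw [frobNorm_sq, Finset.sum_mul_sum]
  refine Finset.sum_congr rfl fun _ _ => Finset.sum_congr rfl fun _ _ => by
    rw [Matrix.vecMulVec_apply]; ring

/-- Testing against the rank-one matrix `(M v) vᵀ` gives `|M v| ^ 2 ≤ b |M v| |v|`. -/
theorem opNorm_le_of_frobInner_le {M : Matrix (Fin d₁) (Fin d₂) ℝ} {b : ℝ} (hb : 0 ≤ b)
    (h : ∀ X : Matrix (Fin d₁) (Fin d₂) ℝ, X.rank ≤ 1 → frobInner M X ≤ b * frobNorm X) :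
    opNorm M ≤ b := by
  refine opNorm_le_of_sum_mulVec_sq_le hb fun v => ?_
  have h1 := h (Matrix.vecMulVec (M.mulVec v) v) (Matrix.rank_vecMulVec_le _ _)
  rw [frobInner_vecMulVec] at h1
  have h2 := frobNorm_vecMulVec_sq (M.mulVec v) v
  simp_rw [← sq] at h1
  set s := ∑ j, (M.mulVec v) j ^ 2
  have hs : 0 ≤ s := by positivity
  have h3 : s ^ 2 ≤ b ^ 2 * (s * ∑ k, v k ^ 2) := by
    rw [← h2, ← mul_pow]
    exact pow_le_pow_left₀ hs h1 2
  rcases hs.eq_or_lt with h0 | h0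
  · rw [← h0]; positivity
  · refine le_of_mul_le_mul_left ?_ h0
    linarith

end MatrixNorms

/-! ### Nets for low-rank matrices. -/

section RankNet

variable {d₁ d₂ : ℕ}

/-- The columns of `Q` are an orthonormal basis of the column space of `X`, and `B` holds the
coordinates of the columns of `X`. -/
theorem exists_mul_eq_of_rank_eq {m : ℕ} (X : Matrix (Fin d₁) (Fin d₂) ℝ) (hX : X.rank = m) :
    ∃ (Q : Matrix (Fin d₁) (Fin m) ℝ) (B : Matrix (Fin m) (Fin d₂) ℝ),
      X = Q * B ∧ (∀ v, ∑ j, (Q.mulVec v) j ^ 2 = ∑ k, v k ^ 2) := by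
  let W : Submodule ℝ (EuclideanSpace ℝ (Fin d₁)) := LinearMap.range (Matrix.toEuclideanLin X)
  have hW : Module.finrank ℝ W = m := by
    rw [← hX, Matrix.rank_eq_finrank_range_toLin X (EuclideanSpace.basisFun (Fin d₁) ℝ).toBasis
      (EuclideanSpace.basisFun (Fin d₂) ℝ).toBasis]
    rw [← Matrix.toEuclideanLin_eq_toLin_orthonormal]
  let b : OrthonormalBasis (Fin m) ℝ W := (stdOrthonormalBasis ℝ W).reindex (finCongr hW)
  refine ⟨Matrix.of fun i j => (b j : EuclideanSpace ℝ (Fin d₁)) i,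
    Matrix.of fun j l => b.repr ⟨Matrix.toEuclideanLin X (EuclideanSpace.single l 1), ⟨_, rfl⟩⟩ j,
    ?_, ?_⟩
  · ext i l
    have h := congrArg (fun w : W => (w : EuclideanSpace ℝ (Fin d₁)) i)
      (b.sum_repr ⟨Matrix.toEuclideanLin X (EuclideanSpace.single l 1), ⟨_, rfl⟩⟩)
    simp [Matrix.toLpLin_apply] at h
    simp [Matrix.mul_apply, ← h, mul_comm, Matrix.toLpLin_apply]
  · intro v
    have h := b.repr.symm.norm_map (WithLp.toLp 2 v)
    have h2 := congrArg (· ^ 2) h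
    simp only [Submodule.coe_norm, EuclideanSpace.real_norm_sq_eq] at h2
    rw [← h2]
    refine Finset.sum_congr rfl fun i _ => ?_
    congr 1
    rw [← b.sum_repr_symm]
    simp [Matrix.mulVec, dotProduct, mul_comm]

/-- Zero padding gives all ranks up to `k` factors of one common size, so a single pair of nets
serves them all. -/
theorem exists_mul_eq_of_rank_le {k : ℕ} (X : Matrix (Fin d₁) (Fin d₂) ℝ) (hX : X.rank ≤ k) :
    ∃ (Q : Matrix (Fin d₁) (Fin k) ℝ) (B : Matrix (Fin k) (Fin d₂) ℝ),
      X = Q * B ∧ opNorm Q ≤ 1 ∧ frobNorm B ≤ frobNorm X := by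
  obtain ⟨p, rfl⟩ := Nat.exists_eq_add_of_le hX
  obtain ⟨Q, B, hQB, hQ⟩ := exists_mul_eq_of_rank_eq X rfl
  refine ⟨Matrix.of fun i => Fin.append (Q i) 0,
    Matrix.of (Fin.append (fun j => B j) 0), ?_, ?_, ?_⟩
  · conv_lhs => rw [hQB]
    ext i l
    simp [Matrix.mul_apply, Fin.sum_univ_add]
  · refine opNorm_le_of_sum_mulVec_sq_le zero_le_one fun v => ?_
    have h := hQ fun j => v (Fin.castAdd p j)
    simp only [Matrix.mulVec, dotProduct, Matrix.of_apply, Fin.sum_univ_add, Fin.append_left,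
      Fin.append_right, Pi.zero_apply, zero_mul, Finset.sum_const_zero, add_zero, one_pow,
      one_mul] at h ⊢
    rw [h]
    have : 0 ≤ ∑ i, v (Fin.natAdd X.rank i) ^ 2 := by positivity
    linarith
  · refine le_of_sq_le_sq (le_of_eq ?_) (frobNorm_nonneg _)
    conv_rhs => rw [hQB]
    rw [frobNorm_sq, frobNorm_sq]
    conv_rhs => rw [Finset.sum_comm]
    simp only [Fin.sum_univ_add, Matrix.of_apply, Fin.append_left,
      Fin.append_right, Pi.zero_apply, Finset.sum_const_zero, add_zero, ne_eq,
      OfNat.ofNat_ne_zero, not_false_eq_true, zero_pow]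
    rw [Finset.sum_comm]
    exact Finset.sum_congr rfl fun l _ => (hQ fun j => B j l).symm

theorem exists_opNorm_net (a b : ℕ) {ε : ℝ} (hε : 0 < ε) :
    ∃ N : Finset (Matrix (Fin a) (Fin b) ℝ), (∀ X ∈ N, opNorm X ≤ 1) ∧
      (∀ X, opNorm X ≤ 1 → ∃ Y ∈ N, opNorm (X - Y) ≤ ε) ∧ (N.card : ℝ) ≤ (1 + 2 / ε) ^ (a * b) := by
  let _ : NormedAddCommGroup (Matrix (Fin a) (Fin b) ℝ) := Matrix.instL2OpNormedAddCommGroup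
  let _ : NormedSpace ℝ (Matrix (Fin a) (Fin b) ℝ) := Matrix.instL2OpNormedSpace
  have h := exists_finset_net (Matrix (Fin a) (Fin b) ℝ) hε
  rw [Module.finrank_matrix] at h
  simp only [Fintype.card_fin, Module.finrank_self, mul_one] at h
  exact h

theorem exists_frobNorm_net (a b : ℕ) {ε : ℝ} (hε : 0 < ε) :
    ∃ N : Finset (Matrix (Fin a) (Fin b) ℝ), (∀ X ∈ N, frobNorm X ≤ 1) ∧
      (∀ X, frobNorm X ≤ 1 → ∃ Y ∈ N, frobNorm (X - Y) ≤ ε) ∧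
      (N.card : ℝ) ≤ (1 + 2 / ε) ^ (a * b) := by
  let _ : NormedAddCommGroup (Matrix (Fin a) (Fin b) ℝ) := Matrix.frobeniusNormedAddCommGroup
  let _ : NormedSpace ℝ (Matrix (Fin a) (Fin b) ℝ) := Matrix.frobeniusNormedSpace
  have h := exists_finset_net (Matrix (Fin a) (Fin b) ℝ) hε
  rw [Module.finrank_matrix] at h
  simp only [Fintype.card_fin, Module.finrank_self, mul_one] at h
  exact h

/-- `N` is an `ε`-net, with two-term error, of the matrices of rank at most `k` in the Frobenius
unit ball. -/
structure IsRankNet (k : ℕ) (ε : ℝ) (N : Finset (Matrix (Fin d₁) (Fin d₂) ℝ)) : Prop where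
  frobNorm_le : ∀ X ∈ N, frobNorm X ≤ 1
  exists_near : ∀ X : Matrix (Fin d₁) (Fin d₂) ℝ, X.rank ≤ k → frobNorm X ≤ 1 →
    ∃ Y ∈ N, ∃ U V : Matrix (Fin d₁) (Fin d₂) ℝ, X = Y + (U + V) ∧ U.rank ≤ k ∧ V.rank ≤ k ∧
      frobNorm U ≤ ε ∧ frobNorm V ≤ ε

/-- With nets for both factors, `QB - Q'B' = Q(B - B') + (Q - Q')B'`. Each summand factors through
dimension `k`, so neither error exceeds rank `k`; this is why the error is kept in two terms. -/
theorem exists_isRankNet (d₁ d₂ k : ℕ) {ε : ℝ} (hε : 0 < ε) :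
    ∃ N : Finset (Matrix (Fin d₁) (Fin d₂) ℝ), IsRankNet k ε N ∧
      (N.card : ℝ) ≤ (1 + 2 / ε) ^ (2 * k * max d₁ d₂) := by
  classical
  obtain ⟨N₁, h1, h1', h1c⟩ := exists_opNorm_net d₁ k hε
  obtain ⟨N₂, h2, h2', h2c⟩ := exists_frobNorm_net k d₂ hε
  refine ⟨(N₁ ×ˢ N₂).image fun p => p.1 * p.2, ⟨?_, ?_⟩, ?_⟩
  · intro X hX
    obtain ⟨⟨Q, B⟩, hQB, rfl⟩ := Finset.mem_image.1 hX
    rw [Finset.mem_product] at hQB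
    exact (frobNorm_mul_le Q B).trans
      (mul_le_one₀ (h1 _ hQB.1) (frobNorm_nonneg _) (h2 _ hQB.2))
  · intro X hXk hX
    obtain ⟨Q, B, rfl, hQ, hB⟩ := exists_mul_eq_of_rank_le X hXk
    obtain ⟨Q', hQ', hQQ⟩ := h1' Q hQ
    obtain ⟨B', hB', hBB⟩ := h2' B (hB.trans hX)
    refine ⟨Q' * B', Finset.mem_image_of_mem _ (Finset.mk_mem_product hQ' hB'),
      Q * (B - B'), (Q - Q') * B', ?_, ?_, ?_, ?_, ?_⟩
    · rw [Matrix.mul_sub, Matrix.sub_mul]; abel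
    · exact (Matrix.rank_mul_le_left _ _).trans ((Matrix.rank_le_card_width _).trans (by simp))
    · exact (Matrix.rank_mul_le_left _ _).trans ((Matrix.rank_le_card_width _).trans (by simp))
    · exact (frobNorm_mul_le _ _).trans
        ((mul_le_of_le_one_left (frobNorm_nonneg _) hQ).trans hBB)
    · exact (frobNorm_mul_le _ _).trans
        ((mul_le_of_le_one_right (opNorm_nonneg _) (h2 _ hB')).trans hQQ)
  · have hbase : 1 ≤ 1 + 2 / ε := by
      have : 0 ≤ 2 / ε := by positivity
      linarith
    calc (((N₁ ×ˢ N₂).image fun p => p.1 * p.2).card : ℝ)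
        ≤ ((N₁ ×ˢ N₂).card : ℝ) := by exact_mod_cast Finset.card_image_le
      _ = N₁.card * N₂.card := by rw [Finset.card_product]; push_cast; rfl
      _ ≤ (1 + 2 / ε) ^ (d₁ * k) * (1 + 2 / ε) ^ (k * d₂) := by gcongr
      _ = (1 + 2 / ε) ^ (d₁ * k + k * d₂) := (pow_add _ _ _).symm
      _ ≤ _ := by
        refine pow_le_pow_right₀ hbase ?_
        have e1 := Nat.mul_le_mul_left k (le_max_left d₁ d₂)
        have e2 := Nat.mul_le_mul_left k (le_max_right d₁ d₂)
        linarith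

/-- A function that is subadditive, absolutely homogeneous and dominated by the Frobenius norm
is controlled on matrices of low rank by its values on a net. -/
theorem IsRankNet.le_of_forall_le {k : ℕ} {ε : ℝ} {N : Finset (Matrix (Fin d₁) (Fin d₂) ℝ)}
    (hN : IsRankNet k ε N) (hε : 2 * ε < 1)
    {p : Matrix (Fin d₁) (Fin d₂) ℝ → ℝ} (hadd : ∀ X Y, p (X + Y) ≤ p X + p Y)
    (hsmul : ∀ (c : ℝ) X, p (c • X) = |c| * p X) {K : ℝ} (hK : ∀ X, p X ≤ K * frobNorm X)
    {m : ℝ} (hm : ∀ X ∈ N, p X ≤ m) (X : Matrix (Fin d₁) (Fin d₂) ℝ) (hX : X.rank ≤ k) :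
    p X ≤ m / (1 - 2 * ε) * frobNorm X := by
  let T : Set ℝ := {x | ∃ Y : Matrix (Fin d₁) (Fin d₂) ℝ, Y.rank ≤ k ∧ frobNorm Y ≤ 1 ∧ p Y = x}
  have hp0 : p 0 = 0 := by simpa using hsmul 0 0
  have hpn : ∀ Y, 0 ≤ p Y := fun Y => by
    have h1 := hadd Y ((-1 : ℝ) • Y)
    rw [hsmul] at h1
    simp [hp0] at h1
    linarith
  have hbdd : BddAbove T := by
    refine ⟨|K|, ?_⟩
    rintro _ ⟨Y, -, h2, rfl⟩
    calc p Y ≤ K * frobNorm Y := hK Y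
      _ ≤ |K| * frobNorm Y := mul_le_mul_of_nonneg_right (le_abs_self K) (frobNorm_nonneg _)
      _ ≤ |K| := mul_le_of_le_one_right (abs_nonneg _) h2
  have hz : frobNorm (0 : Matrix (Fin d₁) (Fin d₂) ℝ) = 0 := frobNorm_eq_zero.2 rfl
  have hTne : T.Nonempty := ⟨p 0, 0, by simp, by simp [hz], rfl⟩
  have hscale : ∀ Y : Matrix (Fin d₁) (Fin d₂) ℝ, Y.rank ≤ k → p Y ≤ sSup T * frobNorm Y := by
    intro Y hY
    rcases (frobNorm_nonneg Y).eq_or_lt with h0 | h0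
    · rw [frobNorm_eq_zero.1 h0.symm]; simp [hp0, hz]
    · have h1 : p ((frobNorm Y)⁻¹ • Y) ≤ sSup T := by
        refine le_csSup hbdd ⟨_, ?_, ?_, rfl⟩
        · rwa [Matrix.rank_smul_of_mem_nonZeroDivisors _
            (mem_nonZeroDivisors_of_ne_zero (inv_ne_zero h0.ne'))]
        · rw [frobNorm_smul, abs_of_pos (inv_pos.2 h0), inv_mul_cancel₀ h0.ne']
      rw [hsmul, abs_of_pos (inv_pos.2 h0), inv_mul_le_iff₀ h0] at h1
      linarith
  have hT0 : 0 ≤ sSup T := le_csSup hbdd ⟨0, by simp, by simp [hz], hp0⟩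
  -- Each of the two errors has rank at most `k`, so it costs at most `ε * sSup T`, which is
  -- absorbed on the left because `2 * ε < 1`. The a priori constant `K` serves only to make the
  -- supremum finite.
  have hT : sSup T ≤ m + 2 * ε * sSup T := by
    refine csSup_le hTne ?_
    rintro _ ⟨Y, hYk, hY, rfl⟩
    obtain ⟨Z, hZ, U, V, rfl, hU, hV, hUε, hVε⟩ := hN.exists_near Y hYk hY
    have e1 := hadd Z (U + V)
    have e2 := hadd U V
    have e3 := hm Z hZ
    have e4 := (hscale U hU).trans (mul_le_mul_of_nonneg_left hUε hT0)
    have e5 := (hscale V hV).trans (mul_le_mul_of_nonneg_left hVε hT0)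
    linarith
  refine (hscale X hX).trans (mul_le_mul_of_nonneg_right ?_ (frobNorm_nonneg _))
  rw [le_div_iff₀ (by linarith)]
  linarith

end RankNet

/-! ### Scalar Taylor remainders. -/

section Calculus

/-- A lower bound on the second derivative gives a quadratic lower bound on the error of the
first-order Taylor expansion. -/
theorem le_sub_sub_deriv_mul_of_le_iteratedDeriv {ψ : ℝ → ℝ} (hψ : ContDiff ℝ 2 ψ) {D : Set ℝ}
    (hD : Convex ℝ D) {m : ℝ} (hm : ∀ x ∈ D, m ≤ iteratedDeriv 2 ψ x) {a b : ℝ} (ha : a ∈ D)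
    (hb : b ∈ D) : m / 2 * (b - a) ^ 2 ≤ ψ b - ψ a - deriv ψ a * (b - a) := by
  have hd : Differentiable ℝ ψ := hψ.differentiable (by norm_num)
  have hd' : Differentiable ℝ (deriv ψ) := by
    have := hψ.differentiable_iteratedDeriv 1 (by norm_num)
    rwa [iteratedDeriv_one] at this
  have h1 : ∀ x, HasDerivAt (fun x => ψ x - m / 2 * x ^ 2) (deriv ψ x - m * x) x := fun x => by
    have h2 := ((hasDerivAt_id x).pow 2).const_mul (m / 2)
    refine ((hd x).hasDerivAt.sub h2).congr_deriv ?_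
    simp; ring
  have h2 : ∀ x, HasDerivAt (fun x => deriv ψ x - m * x) (iteratedDeriv 2 ψ x - m) x := fun x => by
    rw [iteratedDeriv_succ, iteratedDeriv_one]
    refine ((hd' x).hasDerivAt.sub ((hasDerivAt_id x).const_mul m)).congr_deriv ?_
    simp
  -- The claim says that this convex function lies above its tangent at `a`.
  have hconv : ConvexOn ℝ D fun x => ψ x - m / 2 * x ^ 2 := by
    refine convexOn_of_hasDerivWithinAt2_nonneg hD
      (fun x _ => (h1 x).continuousAt.continuousWithinAt)
      (fun x _ => (h1 x).hasDerivWithinAt) (fun x _ => (h2 x).hasDerivWithinAt) ?_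
    intro x hx
    linarith [hm x (interior_subset hx)]
  rcases lt_trichotomy a b with hab | rfl | hab
  · have := hconv.le_slope_of_hasDerivAt ha hb hab (h1 a)
    rw [slope_def_field, le_div_iff₀ (by linarith)] at this
    nlinarith
  · simp
  · have := hconv.slope_le_of_hasDerivAt hb ha hab (h1 a)
    rw [slope_def_field, div_le_iff₀ (by linarith)] at this
    nlinarith

/-- An upper bound on the second derivative gives a quadratic upper bound on the error of the
first-order Taylor expansion. -/
theorem sub_sub_deriv_mul_le_of_iteratedDeriv_le {ψ : ℝ → ℝ} (hψ : ContDiff ℝ 2 ψ) {M : ℝ}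
    (hM : ∀ x, iteratedDeriv 2 ψ x ≤ M) (a b : ℝ) :
    ψ b - ψ a - deriv ψ a * (b - a) ≤ M / 2 * (b - a) ^ 2 := by
  have h := le_sub_sub_deriv_mul_of_le_iteratedDeriv hψ.neg convex_univ (m := -M)
    (fun x _ => by rw [iteratedDeriv_fun_neg]; linarith [hM x]) (Set.mem_univ a) (Set.mem_univ b)
  rw [deriv.fun_neg] at h
  linarith

theorem abs_iteratedDeriv_le_Bupper {ψ : ℝ → ℝ}
    (h : BddAbove (Set.range fun x : ℝ => |iteratedDeriv 2 ψ x|)) (x : ℝ) :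
    |iteratedDeriv 2 ψ x| ≤ Bupper ψ :=
  le_ciSup h x

theorem Blower_le {ψ : ℝ → ℝ} (h : BddAbove (Set.range fun x : ℝ => |iteratedDeriv 2 ψ x|))
    {M x : ℝ} (hx : |x| ≤ M) : Blower ψ M ≤ iteratedDeriv 2 ψ x := by
  refine csInf_le ⟨-Bupper ψ, ?_⟩ ⟨x, hx, rfl⟩
  rintro _ ⟨y, -, rfl⟩
  exact (abs_le.1 (abs_iteratedDeriv_le_Bupper h y)).1

theorem tangent_le {ψ : ℝ → ℝ} (hψ : ContDiff ℝ 2 ψ) (hc : ConvexOn ℝ Set.univ ψ) (a b : ℝ) :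
    0 ≤ ψ b - ψ a - deriv ψ a * (b - a) := by
  have hd := ((hψ.differentiable (by norm_num)) a).hasDerivAt
  rcases lt_trichotomy a b with hab | rfl | hab
  · have := hc.le_slope_of_hasDerivAt (Set.mem_univ a) (Set.mem_univ b) hab hd
    rw [slope_def_field, le_div_iff₀ (by linarith)] at this
    linarith
  · simp
  · have := hc.slope_le_of_hasDerivAt (Set.mem_univ b) (Set.mem_univ a) hab hd
    rw [slope_def_field, div_le_iff₀ (by linarith)] at this
    linarith

end Calculus

/-! ### Gradient and Bregman remainder of the loss. -/

section Loss

variable {d₁ d₂ n : ℕ}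

theorem frobInner_single_right (A : Matrix (Fin d₁) (Fin d₂) ℝ) (j : Fin d₁) (k : Fin d₂) (c : ℝ) :
    frobInner A (Matrix.single j k c) = A j k * c := by
  simp only [frobInner]
  rw [Finset.sum_eq_single j, Finset.sum_eq_single k]
  · simp
  · intro l _ hl; simp [hl.symm]
  · simp
  · intro l _ hl; simp [hl.symm]
  · simp

theorem grad_loss {ψ : ℝ → ℝ} (hψ : Differentiable ℝ ψ) (A : Fin n → Matrix (Fin d₁) (Fin d₂) ℝ)
    (y : Fin n → ℝ) (X : Matrix (Fin d₁) (Fin d₂) ℝ) :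
    grad (loss ψ A y) X =
      (1 / (n : ℝ)) • ∑ i, (deriv ψ (frobInner (A i) X) - y i) • A i := by
  ext j k
  simp only [grad, Matrix.of_apply, loss, frobInner_add_right, frobInner_smul_right,
    frobInner_single_right, mul_one, Matrix.smul_apply, Matrix.sum_apply, smul_eq_mul]
  refine HasDerivAt.deriv ?_
  refine HasDerivAt.const_mul _ (HasDerivAt.fun_sum fun i _ => ?_)
  have h1 : HasDerivAt (fun t : ℝ => frobInner (A i) X + t * A i j k) (A i j k) 0 := by
    simpa using ((hasDerivAt_id (0 : ℝ)).mul_const (A i j k)).const_add (frobInner (A i) X)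
  have h2 : HasDerivAt ψ (deriv ψ (frobInner (A i) X)) (frobInner (A i) X + 0 * A i j k) := by
    simpa using (hψ (frobInner (A i) X)).hasDerivAt
  refine ((h2.comp (0 : ℝ) h1).sub (h1.const_mul (y i))).congr_deriv ?_
  ring

theorem frobInner_comm (A B : Matrix (Fin d₁) (Fin d₂) ℝ) : frobInner A B = frobInner B A := by
  simp only [frobInner, mul_comm]

theorem frobInner_sum_right {ι : Type*} (s : Finset ι) (A : Matrix (Fin d₁) (Fin d₂) ℝ)
    (B : ι → Matrix (Fin d₁) (Fin d₂) ℝ) :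
    frobInner A (∑ i ∈ s, B i) = ∑ i ∈ s, frobInner A (B i) := by
  classical
  induction s using Finset.induction_on with
  | empty => simp [frobInner]
  | insert i s hi ih => rw [Finset.sum_insert hi, Finset.sum_insert hi, frobInner_add_right, ih]

theorem frobInner_grad_loss {ψ : ℝ → ℝ} (hψ : Differentiable ℝ ψ)
    (A : Fin n → Matrix (Fin d₁) (Fin d₂) ℝ) (y : Fin n → ℝ) (X Z : Matrix (Fin d₁) (Fin d₂) ℝ) :
    frobInner (grad (loss ψ A y) X) Z =
      1 / (n : ℝ) * ∑ i, (deriv ψ (frobInner (A i) X) - y i) * frobInner (A i) Z := by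
  rw [grad_loss hψ, frobInner_comm, frobInner_smul_right, frobInner_sum_right]
  simp only [frobInner_smul_right]
  simp only [frobInner_comm Z]

/-- The terms linear in `y` cancel, so curvature depends on the measurements alone. -/
theorem bregman_loss {ψ : ℝ → ℝ} (hψ : Differentiable ℝ ψ)
    (A : Fin n → Matrix (Fin d₁) (Fin d₂) ℝ) (y : Fin n → ℝ) (X Y : Matrix (Fin d₁) (Fin d₂) ℝ) :
    loss ψ A y Y - loss ψ A y X - frobInner (grad (loss ψ A y) X) (Y - X) =
      1 / (n : ℝ) * ∑ i, (ψ (frobInner (A i) Y) - ψ (frobInner (A i) X) -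
        deriv ψ (frobInner (A i) X) * (frobInner (A i) Y - frobInner (A i) X)) := by
  rw [frobInner_grad_loss hψ, loss, loss, ← mul_sub, ← mul_sub, ← Finset.sum_sub_distrib,
    ← Finset.sum_sub_distrib]
  congr 1
  refine Finset.sum_congr rfl fun i _ => ?_
  rw [frobInner_sub_right]
  ring

end Loss

/-! ### Exponential moments of Gaussian squares. -/

section Gaussian

theorem hasLaw_sum_gaussianReal {Ω ι : Type*} [MeasurableSpace Ω] {P : Measure Ω} [Fintype ι]
    {X : ι → Ω → ℝ} {v : ι → NNReal} (hX : ∀ i, HasLaw (X i) (gaussianReal 0 (v i)) P)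
    (hind : iIndepFun X P) :
    HasLaw (fun ω => ∑ i, X i ω) (gaussianReal 0 (∑ i, v i)) P := by
  have := hind.isProbabilityMeasure
  have hm : ∀ i, AEMeasurable (X i) P := fun i => (hX i).aemeasurable
  refine ⟨by fun_prop, ?_⟩
  have : IsProbabilityMeasure (P.map fun ω => ∑ i, X i ω) :=
    Measure.isProbabilityMeasure_map (by fun_prop)
  refine Measure.ext_of_charFun ?_
  rw [hind.charFun_map_fun_sum_eq_prod hm]
  ext t
  rw [Finset.prod_apply]
  simp only [(hX _).map_eq, charFun_gaussianReal, ← Complex.exp_sum]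
  simp [Finset.sum_mul, Finset.sum_div]

theorem hasLaw_pi_sum_mul {ι : Type*} [Fintype ι] (x : ι → ℝ) :
    HasLaw (fun a : ι → ℝ => ∑ k, a k * x k)
      (gaussianReal 0 (∑ k, NNReal.mk (x k ^ 2) (sq_nonneg _)))
      (Measure.pi fun _ : ι => gaussianReal 0 1) := by
  refine hasLaw_sum_gaussianReal (X := fun k (a : ι → ℝ) => a k * x k) (fun k => ?_) ?_
  · have h : HasLaw (fun a : ι → ℝ => a k) (gaussianReal 0 1)
        (Measure.pi fun _ : ι => gaussianReal 0 1) :=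
      (measurePreserving_eval (fun _ : ι => gaussianReal 0 1) k).hasLaw
    have h2 := gaussianReal_mul_const h (x k)
    rwa [mul_zero, mul_one] at h2
  · exact iIndepFun_pi (X := fun k a => a * x k) (μ := fun _ => gaussianReal 0 1)
      fun k => by fun_prop

variable {d₁ d₂ : ℕ}

instance : IsProbabilityMeasure (gaussianMatrix d₁ d₂) := by
  unfold gaussianMatrix
  exact inferInstanceAs (IsProbabilityMeasure
    (Measure.pi fun _ : Fin d₁ => Measure.pi fun _ : Fin d₂ => gaussianReal 0 1))

/-- The variance of `⟨A, X⟩` for a standard Gaussian matrix `A`. -/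
noncomputable def frobVar (X : Matrix (Fin d₁) (Fin d₂) ℝ) : NNReal :=
  NNReal.mk (frobNorm X ^ 2) (sq_nonneg _)

theorem hasLaw_frobInner (X : Matrix (Fin d₁) (Fin d₂) ℝ) :
    HasLaw (fun A => frobInner A X) (gaussianReal 0 (frobVar X)) (gaussianMatrix d₁ d₂) := by
  have hv : frobVar X = ∑ j, ∑ k, NNReal.mk (X j k ^ 2) (sq_nonneg _) := by
    refine NNReal.eq ?_
    simp only [NNReal.coe_sum, NNReal.coe_mk, frobVar]
    exact frobNorm_sq X
  rw [hv]
  refine hasLaw_sum_gaussianReal (P := gaussianMatrix d₁ d₂)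
    (X := fun j (A : Matrix (Fin d₁) (Fin d₂) ℝ) => ∑ k, A j k * X j k) (fun j => ?_) ?_
  · have h : HasLaw (fun A : Fin d₁ → Fin d₂ → ℝ => A j)
        (Measure.pi fun _ : Fin d₂ => gaussianReal 0 1)
        (Measure.pi fun _ : Fin d₁ => Measure.pi fun _ : Fin d₂ => gaussianReal 0 1) :=
      (measurePreserving_eval (fun _ : Fin d₁ => Measure.pi fun _ : Fin d₂ => gaussianReal 0 1)
        j).hasLaw
    exact (hasLaw_pi_sum_mul fun k => X j k).comp h
  · exact iIndepFun_pi (X := fun j (a : Fin d₂ → ℝ) => ∑ k, a k * X j k)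
      (μ := fun _ : Fin d₁ => Measure.pi fun _ : Fin d₂ => gaussianReal 0 1)
      fun k => Measurable.aemeasurable (by fun_prop)

theorem lintegral_exp_mul_sq_gaussianReal_one {t : ℝ} (ht : t < 1 / 2) :
    ∫⁻ x, ENNReal.ofReal (Real.exp (t * x ^ 2)) ∂(gaussianReal 0 1) =
      ENNReal.ofReal (1 / √(1 - 2 * t)) := by
  rw [gaussianReal_of_var_ne_zero 0 one_ne_zero,
    lintegral_withDensity_eq_lintegral_mul _ (measurable_gaussianPDF _ _) (by fun_prop)]
  have h1 : ∀ x : ℝ, (gaussianPDF 0 1 * fun x => ENNReal.ofReal (Real.exp (t * x ^ 2))) x =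
      ENNReal.ofReal ((√(2 * Real.pi))⁻¹ * Real.exp (-(1 / 2 - t) * x ^ 2)) := fun x => by
    rw [Pi.mul_apply, gaussianPDF, ← ENNReal.ofReal_mul (gaussianPDFReal_nonneg _ _ _),
      gaussianPDFReal, mul_assoc, ← Real.exp_add]
    congr 2
    · simp
    · congr 1
      simp
      ring
  simp_rw [h1]
  rw [← ofReal_integral_eq_lintegral_ofReal, integral_const_mul, integral_gaussian]
  · congr 1
    have hdiv : 1 / √(1 - 2 * t) = √((1 - 2 * t)⁻¹) := by rw [Real.sqrt_inv, one_div]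
    rw [hdiv, ← Real.sqrt_inv, ← Real.sqrt_mul (by positivity)]
    congr 1
    have : (1 : ℝ) / 2 - t ≠ 0 := by linarith
    have : (1 : ℝ) - 2 * t ≠ 0 := by linarith
    have := Real.pi_ne_zero
    field_simp
  · exact (integrable_exp_neg_mul_sq (by linarith)).const_mul _
  · exact Filter.Eventually.of_forall fun x => by positivity

theorem one_div_sqrt_one_sub_le {x : ℝ} (hx : |x| ≤ 1 / 2) :
    1 / √(1 - x) ≤ Real.exp (x / 2 + x ^ 2) := by
  obtain ⟨h1, h2⟩ := abs_le.1 hx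
  have hpos : 0 < 1 - x := by linarith
  have hlog := Real.one_sub_inv_le_log_of_pos hpos
  have h3 : -x - 2 * x ^ 2 ≤ 1 - (1 - x)⁻¹ := by
    have h4 : 1 - (1 - x)⁻¹ = -x / (1 - x) := by field_simp; ring
    rw [h4, le_div_iff₀ hpos]
    nlinarith [sq_nonneg x]
  rw [Real.sqrt_eq_rpow, one_div, ← Real.rpow_neg hpos.le, Real.rpow_def_of_pos hpos]
  exact Real.exp_le_exp.2 (by linarith)

theorem lintegral_exp_mul_sq_le {v : NNReal} (hv : v ≤ 1) {t : ℝ} (ht : |t| ≤ 1 / 4) :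
    ∫⁻ x, ENNReal.ofReal (Real.exp (t * x ^ 2)) ∂(gaussianReal 0 v) ≤
      ENNReal.ofReal (Real.exp (t * v + 4 * t ^ 2)) := by
  have hmap : gaussianReal 0 v = (gaussianReal 0 1).map (√(v : ℝ) * ·) := by
    rw [gaussianReal_map_const_mul, mul_zero, mul_one]
    congr
    ext
    exact (Real.sq_sqrt v.2).symm
  have hv' : (v : ℝ) ≤ 1 := hv
  have hv0 : (0 : ℝ) ≤ v := v.2
  have htv : |2 * (t * v)| ≤ 1 / 2 := by
    rw [abs_mul, abs_mul, abs_of_nonneg hv0, abs_two]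
    nlinarith [abs_nonneg t]
  rw [hmap, lintegral_map (by fun_prop) (by fun_prop)]
  have h1 : ∀ x : ℝ, t * (√(v : ℝ) * x) ^ 2 = (t * v) * x ^ 2 := fun x => by
    rw [mul_pow, Real.sq_sqrt hv0]; ring
  simp_rw [h1]
  rw [lintegral_exp_mul_sq_gaussianReal_one (by linarith [(abs_le.1 htv).2])]
  refine ENNReal.ofReal_le_ofReal ((one_div_sqrt_one_sub_le htv).trans (Real.exp_le_exp.2 ?_))
  have : (v : ℝ) ^ 2 ≤ 1 := pow_le_one₀ hv0 hv'
  nlinarith [sq_nonneg t]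

/-- Soft thresholding of the absolute value. -/
noncomputable def softAbs (T x : ℝ) : ℝ := max (|x| - T) 0

theorem measurable_softAbs (T : ℝ) : Measurable (softAbs T) := by
  unfold softAbs; fun_prop

/-- When `|x| ≥ T`, `(|x| - T) ^ 2 / 8 ≤ x ^ 2 / 4 - T ^ 2 / 8`; otherwise the exponential is `1`.
The excess over `1` thus gains the factor `exp (-T ^ 2 / 8)`, and large measurements contribute
little. -/
theorem lintegral_exp_softAbs_sq_le {v : NNReal} (hv : v ≤ 1) {T : ℝ} (hT : 0 ≤ T) :
    ∫⁻ x, ENNReal.ofReal (Real.exp (1 / 8 * softAbs T x ^ 2)) ∂(gaussianReal 0 v) ≤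
      ENNReal.ofReal (Real.exp (2 * Real.exp (-(T ^ 2 / 8)))) := by
  have hpt : ∀ x : ℝ, Real.exp (1 / 8 * softAbs T x ^ 2) ≤
      1 + Real.exp (-(T ^ 2 / 8)) * Real.exp (1 / 4 * x ^ 2) := fun x => by
    unfold softAbs
    rcases le_total |x| T with h | h
    · rw [max_eq_right (by linarith)]
      have : 0 ≤ Real.exp (-(T ^ 2 / 8)) * Real.exp (1 / 4 * x ^ 2) := by positivity
      simpa using this
    · rw [max_eq_left (by linarith), ← Real.exp_add]
      have h2 : Real.exp (1 / 8 * (|x| - T) ^ 2) ≤ Real.exp (-(T ^ 2 / 8) + 1 / 4 * x ^ 2) := by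
        refine Real.exp_le_exp.2 ?_
        rw [← sq_abs x]
        nlinarith [mul_nonneg hT (abs_nonneg x), mul_nonneg hT (sub_nonneg.2 h)]
      linarith
  calc ∫⁻ x, ENNReal.ofReal (Real.exp (1 / 8 * softAbs T x ^ 2)) ∂(gaussianReal 0 v)
      ≤ ∫⁻ x, (1 + ENNReal.ofReal (Real.exp (-(T ^ 2 / 8))) *
          ENNReal.ofReal (Real.exp (1 / 4 * x ^ 2))) ∂(gaussianReal 0 v) := by
        refine lintegral_mono fun x => ?_
        rw [← ENNReal.ofReal_mul (by positivity), ← ENNReal.ofReal_one,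
          ← ENNReal.ofReal_add (by positivity) (by positivity)]
        exact ENNReal.ofReal_le_ofReal (hpt x)
    _ = 1 + ENNReal.ofReal (Real.exp (-(T ^ 2 / 8))) *
          ∫⁻ x, ENNReal.ofReal (Real.exp (1 / 4 * x ^ 2)) ∂(gaussianReal 0 v) := by
        rw [lintegral_add_left measurable_const, lintegral_const_mul _ (by fun_prop)]
        simp
    _ ≤ 1 + ENNReal.ofReal (Real.exp (-(T ^ 2 / 8))) * ENNReal.ofReal 2 := by
        gcongr
        refine (lintegral_exp_mul_sq_le hv (by norm_num)).trans (ENNReal.ofReal_le_ofReal ?_)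
        have h1 : (v : ℝ) ≤ 1 := hv
        calc Real.exp (1 / 4 * v + 4 * (1 / 4) ^ 2) ≤ Real.exp (1 / 2) :=
              Real.exp_le_exp.2 (by norm_num; linarith)
          _ ≤ 2 := by
              have h2 := Real.exp_one_lt_d9
              have h3 : Real.exp (1 / 2) ^ 2 = Real.exp 1 := by
                rw [← Real.exp_nat_mul]; norm_num
              nlinarith [Real.exp_pos (1 / 2)]
    _ = ENNReal.ofReal (1 + Real.exp (-(T ^ 2 / 8)) * 2) := by
        rw [ENNReal.ofReal_add zero_le_one (by positivity), ENNReal.ofReal_mul (by positivity),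
          ENNReal.ofReal_one]
    _ ≤ _ := by
        refine ENNReal.ofReal_le_ofReal ?_
        have := Real.add_one_le_exp (2 * Real.exp (-(T ^ 2 / 8)))
        linarith

end Gaussian

/-! ### Chernoff bound for i.i.d. sums. -/

section Chernoff

/-- The Chernoff bound for a sum of a function of independent, identically distributed
variables. -/
theorem measure_le_sum_le {Ω E : Type*} [MeasurableSpace Ω] [MeasurableSpace E] {P : Measure Ω}
    {μ : Measure E} [IsProbabilityMeasure μ] {n : ℕ} {X : Fin n → Ω → E} (hind : iIndepFun X P)
    (hX : ∀ i, HasLaw (X i) μ P) {g : E → ℝ} (hg : Measurable g) {b : ℝ}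
    (hb : ∫⁻ x, ENNReal.ofReal (Real.exp (g x)) ∂μ ≤ ENNReal.ofReal (Real.exp b)) (t : ℝ) :
    P {ω | t ≤ ∑ i, g (X i ω)} ≤ ENNReal.ofReal (Real.exp (n * b - t)) := by
  have hlaw := hind.hasLaw_pi hX
  rw [hlaw.measure_eq (p := fun x => t ≤ ∑ i, g (x i))
    (measurableSet_le measurable_const (by fun_prop))]
  have hsub : {x : Fin n → E | t ≤ ∑ i, g (x i)} ⊆
      {x | ENNReal.ofReal (Real.exp t) ≤ ∏ i, ENNReal.ofReal (Real.exp (g (x i)))} := by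
    intro x hx
    simp only [Set.mem_ofPred_eq] at hx ⊢
    rw [← ENNReal.ofReal_prod_of_nonneg (fun i _ => (Real.exp_pos _).le), ← Real.exp_sum]
    exact ENNReal.ofReal_le_ofReal (Real.exp_le_exp.2 hx)
  have hprod : ∫⁻ x, ∏ i, ENNReal.ofReal (Real.exp (g (x i))) ∂(Measure.pi fun _ : Fin n => μ) ≤
      ENNReal.ofReal (Real.exp (n * b)) := by
    have hm : Measurable fun x => ENNReal.ofReal (Real.exp (g x)) := by fun_prop
    rw [lintegral_prod_eq_prod_lintegral_of_indepFun Finset.univ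
      (fun i (x : Fin n → E) => ENNReal.ofReal (Real.exp (g (x i))))
      (iIndepFun_pi (X := fun _ x => ENNReal.ofReal (Real.exp (g x)))
        fun _ => hm.aemeasurable) (fun i => by fun_prop)]
    calc ∏ i : Fin n, ∫⁻ x, ENNReal.ofReal (Real.exp (g (x i))) ∂(Measure.pi fun _ : Fin n => μ)
        ≤ ∏ _i : Fin n, ENNReal.ofReal (Real.exp b) := by
          refine Finset.prod_le_prod' fun i _ => ?_
          rwa [(measurePreserving_eval (fun _ : Fin n => μ) i).lintegral_comp hm]
      _ = ENNReal.ofReal (Real.exp (n * b)) := by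
          rw [Finset.prod_const, Finset.card_univ, Fintype.card_fin,
            ← ENNReal.ofReal_pow (Real.exp_pos _).le, ← Real.exp_nat_mul]
  refine (measure_mono hsub).trans ?_
  refine (meas_ge_le_lintegral_div (Measurable.aemeasurable (by fun_prop))
    (ENNReal.ofReal_pos.2 (Real.exp_pos t)).ne' ENNReal.ofReal_ne_top).trans ?_
  rw [Real.exp_sub, ENNReal.ofReal_div_of_pos (Real.exp_pos t)]
  exact ENNReal.div_le_div_right hprod _

end Chernoff

/-! ### Moments under the joint law of measurement and response. -/

section PairLaw

variable {d₁ d₂ : ℕ} {ν : Measure ℝ} {ψ : ℝ → ℝ} {s : ℝ}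

theorem measurable_frobInner_left (X : Matrix (Fin d₁) (Fin d₂) ℝ) :
    Measurable fun A => frobInner A X := by
  unfold frobInner
  refine Finset.measurable_fun_sum _ fun j _ => Finset.measurable_fun_sum _ fun k _ => ?_
  refine Measurable.mul_const ?_ _
  exact (measurable_pi_apply k).comp (measurable_pi_apply (X := fun _ : Fin d₁ => Fin d₂ → ℝ) j)

theorem measurable_glmDensity_frobInner (hψ : Continuous ψ) (X : Matrix (Fin d₁) (Fin d₂) ℝ) :
    Measurable fun p : Matrix (Fin d₁) (Fin d₂) ℝ × ℝ => glmDensity ψ s (frobInner p.1 X) p.2 := by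
  have h1 : Measurable fun p : Matrix (Fin d₁) (Fin d₂) ℝ × ℝ => frobInner p.1 X :=
    (measurable_frobInner_left X).comp measurable_fst
  have h2 := hψ.measurable
  unfold glmDensity
  fun_prop

theorem lintegral_pairLaw [SFinite ν] (hψ : Continuous ψ) (X : Matrix (Fin d₁) (Fin d₂) ℝ)
    {f : Matrix (Fin d₁) (Fin d₂) ℝ × ℝ → ENNReal} (hf : Measurable f) :
    ∫⁻ p, f p ∂(pairLaw ν ψ s X) = ∫⁻ A, ∫⁻ y, glmDensity ψ s (frobInner A X) y * f (A, y) ∂ν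
      ∂(gaussianMatrix d₁ d₂) := by
  rw [pairLaw, lintegral_withDensity_eq_lintegral_mul _ (measurable_glmDensity_frobInner hψ X) hf,
    lintegral_prod _ ((measurable_glmDensity_frobInner hψ X).mul hf).aemeasurable]
  rfl

theorem lintegral_pairLaw_fst [SFinite ν] (hψ : IsLogPartition ν ψ s)
    (X : Matrix (Fin d₁) (Fin d₂) ℝ) {f : Matrix (Fin d₁) (Fin d₂) ℝ → ENNReal}
    (hf : Measurable f) :
    ∫⁻ p, f p.1 ∂(pairLaw ν ψ s X) = ∫⁻ A, f A ∂(gaussianMatrix d₁ d₂) := by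
  rw [lintegral_pairLaw hψ.contDiff.continuous X (f := fun p => f p.1) (by fun_prop)]
  refine lintegral_congr fun A => ?_
  change ∫⁻ y, glmDensity ψ s (frobInner A X) y * f A ∂ν = f A
  rw [lintegral_mul_const, hψ.normalized, one_mul]
  unfold glmDensity
  fun_prop

theorem isProbabilityMeasure_pairLaw [SFinite ν] (hψ : IsLogPartition ν ψ s)
    (X : Matrix (Fin d₁) (Fin d₂) ℝ) : IsProbabilityMeasure (pairLaw ν ψ s X) := by
  constructor
  rw [← lintegral_one, lintegral_pairLaw_fst hψ X (f := fun _ => 1) measurable_const]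
  simp

theorem lintegral_pairLaw_frobInner [SFinite ν] (hψ : IsLogPartition ν ψ s)
    (X Z : Matrix (Fin d₁) (Fin d₂) ℝ) {f : ℝ → ENNReal} (hf : Measurable f) :
    ∫⁻ p, f (frobInner p.1 Z) ∂(pairLaw ν ψ s X) = ∫⁻ x, f x ∂(gaussianReal 0 (frobVar Z)) := by
  rw [lintegral_pairLaw_fst hψ X (f := fun A => f (frobInner A Z))
    (hf.comp (measurable_frobInner_left Z))]
  exact (hasLaw_frobInner Z).lintegral_comp hf.aemeasurable

/-- The centred response is sub-Gaussian. -/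
theorem lintegral_glmDensity_mul_exp_le (hs : 0 < s) (hψ : IsLogPartition ν ψ s) {B : ℝ}
    (hB : ∀ x, iteratedDeriv 2 ψ x ≤ B) (θ u : ℝ) :
    ∫⁻ y, glmDensity ψ s θ y * ENNReal.ofReal (Real.exp (u * (y - deriv ψ θ))) ∂ν ≤
      ENNReal.ofReal (Real.exp (s * B * u ^ 2 / 2)) := by
  -- Exponential tilting: the factor `exp (u * y)` moves the natural parameter from `θ` to `θ + s *
  -- u`. Normalization at the new parameter leaves only a Taylor remainder of `ψ`.
  have h1 : ∀ y, glmDensity ψ s θ y * ENNReal.ofReal (Real.exp (u * (y - deriv ψ θ))) =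
      glmDensity ψ s (θ + s * u) y *
        ENNReal.ofReal (Real.exp ((ψ (θ + s * u) - ψ θ) / s - u * deriv ψ θ)) := fun y => by
    rw [glmDensity, glmDensity, ← ENNReal.ofReal_mul (Real.exp_pos _).le,
      ← ENNReal.ofReal_mul (Real.exp_pos _).le, ← Real.exp_add, ← Real.exp_add]
    congr 2
    field_simp
    ring
  simp_rw [h1]
  rw [lintegral_mul_const _ (by unfold glmDensity; fun_prop), hψ.normalized, one_mul]
  refine ENNReal.ofReal_le_ofReal (Real.exp_le_exp.2 ?_)
  have h2 := sub_sub_deriv_mul_le_of_iteratedDeriv_le hψ.contDiff hB θ (θ + s * u)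
  rw [sub_le_iff_le_add, div_le_iff₀ hs]
  nlinarith

/-- Integrating out the response leaves `exp (q / 2 * ⟨A, Z⟩ ^ 2)`, a Gaussian square moment. The
condition `q ≤ 1 / 2` keeps its exponent within range and gives `q / 2 + q ^ 2 ≤ q`. -/
theorem lintegral_pairLaw_exp_score_le [SFinite ν] (hs : 0 < s) (hψ : IsLogPartition ν ψ s) {B : ℝ}
    (hB0 : 0 ≤ B) (hB : ∀ x, iteratedDeriv 2 ψ x ≤ B) (X Z : Matrix (Fin d₁) (Fin d₂) ℝ)
    (hZ : frobNorm Z ≤ 1) {u q : ℝ} (hu : s * B * u ^ 2 = q) (hq : q ≤ 1 / 2) :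
    ∫⁻ p, ENNReal.ofReal (Real.exp (u * ((deriv ψ (frobInner p.1 X) - p.2) * frobInner p.1 Z)))
      ∂(pairLaw ν ψ s X) ≤ ENNReal.ofReal (Real.exp q) := by
  have hq0 : 0 ≤ q := by rw [← hu]; positivity
  have hm1 : Measurable fun p : Matrix (Fin d₁) (Fin d₂) ℝ × ℝ => frobInner p.1 X :=
    (measurable_frobInner_left X).comp measurable_fst
  have hm2 : Measurable fun p : Matrix (Fin d₁) (Fin d₂) ℝ × ℝ => frobInner p.1 Z :=
    (measurable_frobInner_left Z).comp measurable_fst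
  have hm3 : Measurable (deriv ψ) := measurable_deriv ψ
  rw [lintegral_pairLaw hψ.contDiff.continuous X (by fun_prop)]
  calc ∫⁻ A, ∫⁻ y, glmDensity ψ s (frobInner A X) y * ENNReal.ofReal (Real.exp
          (u * ((deriv ψ (frobInner A X) - y) * frobInner A Z))) ∂ν ∂(gaussianMatrix d₁ d₂)
      ≤ ∫⁻ A, ENNReal.ofReal (Real.exp (q / 2 * frobInner A Z ^ 2)) ∂(gaussianMatrix d₁ d₂) := by
        refine lintegral_mono fun A => ?_
        have h := lintegral_glmDensity_mul_exp_le hs hψ hB (frobInner A X) (-u * frobInner A Z)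
        convert h using 1
        · refine lintegral_congr fun y => ?_
          congr 3
          ring
        · congr 2
          rw [← hu]
          ring
    _ = ∫⁻ x, ENNReal.ofReal (Real.exp (q / 2 * x ^ 2)) ∂(gaussianReal 0 (frobVar Z)) :=
        (hasLaw_frobInner Z).lintegral_comp
          (f := fun x => ENNReal.ofReal (Real.exp (q / 2 * x ^ 2))) (by fun_prop)
    _ ≤ ENNReal.ofReal (Real.exp (q / 2 * frobVar Z + 4 * (q / 2) ^ 2)) := by
        refine lintegral_exp_mul_sq_le ?_ ?_
        · exact pow_le_one₀ (frobNorm_nonneg Z) hZ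
        · rw [abs_of_nonneg (by linarith)]; linarith
    _ ≤ _ := by
        refine ENNReal.ofReal_le_ofReal (Real.exp_le_exp.2 ?_)
        have h1 : (frobVar Z : ℝ) ≤ 1 := pow_le_one₀ (frobNorm_nonneg Z) hZ
        nlinarith

end PairLaw

/-! ### Deterministic consequences of regularity on a net. -/

section RestrictedIsometry

variable {d₁ d₂ n : ℕ}

/-- The vector of measurements `(⟨Aᵢ, X⟩)ᵢ`. -/
noncomputable def sensing (A : Fin n → Matrix (Fin d₁) (Fin d₂) ℝ)
    (X : Matrix (Fin d₁) (Fin d₂) ℝ) : EuclideanSpace ℝ (Fin n) :=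
  WithLp.toLp 2 fun i => frobInner (A i) X

variable {A : Fin n → Matrix (Fin d₁) (Fin d₂) ℝ}

theorem norm_sensing_sq (X : Matrix (Fin d₁) (Fin d₂) ℝ) :
    ‖sensing A X‖ ^ 2 = ∑ i, frobInner (A i) X ^ 2 := by
  rw [EuclideanSpace.real_norm_sq_eq]
  rfl

theorem sensing_add (X Y : Matrix (Fin d₁) (Fin d₂) ℝ) :
    sensing A (X + Y) = sensing A X + sensing A Y := by
  ext i
  exact frobInner_add_right _ _ _

theorem sensing_smul (c : ℝ) (X : Matrix (Fin d₁) (Fin d₂) ℝ) :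
    sensing A (c • X) = c • sensing A X := by
  ext i
  exact frobInner_smul_right _ _ _

theorem norm_sensing_le (X : Matrix (Fin d₁) (Fin d₂) ℝ) :
    ‖sensing A X‖ ≤ √(∑ i, frobNorm (A i) ^ 2) * frobNorm X := by
  refine le_of_sq_le_sq ?_ (mul_nonneg (Real.sqrt_nonneg _) (frobNorm_nonneg _))
  rw [norm_sensing_sq, mul_pow, Real.sq_sqrt (by positivity), Finset.sum_mul]
  refine Finset.sum_le_sum fun i _ => ?_
  rw [← mul_pow, ← sq_abs]
  exact pow_le_pow_left₀ (abs_nonneg _) (abs_frobInner_le _ _) 2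

/-- The measurements behave on the net `N` as they do in expectation, up to small errors. -/
structure IsRegularOn (A : Fin n → Matrix (Fin d₁) (Fin d₂) ℝ) (T : ℝ)
    (N : Finset (Matrix (Fin d₁) (Fin d₂) ℝ)) : Prop where
  sum_le : ∀ Y ∈ N, ∑ i, frobInner (A i) Y ^ 2 ≤ n * (1 + 1 / 100)
  le_sum : ∀ Y ∈ N, n * (frobNorm Y ^ 2 - 1 / 100) ≤ ∑ i, frobInner (A i) Y ^ 2
  soft_le : ∀ Y ∈ N, ∑ i, softAbs T (frobInner (A i) Y) ^ 2 ≤ n / 400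

variable {k : ℕ} {T : ℝ} {N : Finset (Matrix (Fin d₁) (Fin d₂) ℝ)}

theorem IsRegularOn.norm_sensing_le (hA : IsRegularOn A T N) (hN : IsRankNet k (1 / 1000) N)
    {X : Matrix (Fin d₁) (Fin d₂) ℝ} (hX : X.rank ≤ k) :
    ‖sensing A X‖ ≤ 1.01 * √n * frobNorm X := by
  have h := hN.le_of_forall_le (by norm_num) (p := fun X => ‖sensing A X‖)
    (fun X Y => by rw [sensing_add]; exact norm_add_le _ _)
    (fun c X => by rw [sensing_smul, norm_smul, Real.norm_eq_abs])
    RGLM.norm_sensing_le (m := 1.007 * √n) (fun Y hY => by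
      refine le_of_sq_le_sq ?_ (by positivity)
      rw [norm_sensing_sq, mul_pow, Real.sq_sqrt n.cast_nonneg]
      have := hA.sum_le Y hY
      have : (0 : ℝ) ≤ n := n.cast_nonneg
      linarith) X hX
  refine h.trans (mul_le_mul_of_nonneg_right ?_ (frobNorm_nonneg _))
  rw [div_le_iff₀ (by norm_num)]
  nlinarith [Real.sqrt_nonneg n]

theorem IsRegularOn.sum_sq_le (hA : IsRegularOn A T N) (hN : IsRankNet k (1 / 1000) N)
    {X : Matrix (Fin d₁) (Fin d₂) ℝ} (hX : X.rank ≤ k) :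
    ∑ i, frobInner (A i) X ^ 2 ≤ 1.0201 * n * frobNorm X ^ 2 := by
  have h := pow_le_pow_left₀ (norm_nonneg _) (hA.norm_sensing_le hN hX) 2
  rw [norm_sensing_sq, mul_pow, mul_pow, Real.sq_sqrt n.cast_nonneg] at h
  linarith

theorem IsRegularOn.norm_sensing_error_le (hA : IsRegularOn A T N)
    (hN : IsRankNet k (1 / 1000) N) {U V : Matrix (Fin d₁) (Fin d₂) ℝ} (hU : U.rank ≤ k)
    (hV : V.rank ≤ k) (hUε : frobNorm U ≤ 1 / 1000) (hVε : frobNorm V ≤ 1 / 1000) :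
    ‖sensing A (U + V)‖ ≤ 0.00202 * √n := by
  rw [sensing_add]
  have h1 := hA.norm_sensing_le hN hU
  have h2 := hA.norm_sensing_le hN hV
  have h3 : 0 ≤ 1.01 * √n := by positivity
  have h4 := mul_le_mul_of_nonneg_left hUε h3
  have h5 := mul_le_mul_of_nonneg_left hVε h3
  linarith [norm_add_le (sensing A U) (sensing A V)]

/-- A lower bound does not pass through a supremum argument, so a nearby net point is used, with the
error controlled by the upper bound already proved. -/
theorem IsRegularOn.le_sum_sq (hA : IsRegularOn A T N) (hN : IsRankNet k (1 / 1000) N)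
    {X : Matrix (Fin d₁) (Fin d₂) ℝ} (hX : X.rank ≤ k) (hX1 : frobNorm X = 1) :
    0.98 * n ≤ ∑ i, frobInner (A i) X ^ 2 := by
  obtain ⟨Y, hY, U, V, rfl, hU, hV, hUε, hVε⟩ := hN.exists_near X hX hX1.le
  have h1 := hA.norm_sensing_error_le hN hU hV hUε hVε
  have h2 : 0.998 ≤ frobNorm Y := by
    have := frobNorm_add_le Y (U + V)
    have := frobNorm_add_le U V
    linarith
  have hn : (0 : ℝ) ≤ n := n.cast_nonneg
  have h3 : 0.9929 * √n ≤ ‖sensing A Y‖ := by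
    refine le_of_sq_le_sq ?_ (norm_nonneg _)
    rw [norm_sensing_sq, mul_pow, Real.sq_sqrt hn]
    have h4 : 0.998 ^ 2 ≤ frobNorm Y ^ 2 := pow_le_pow_left₀ (by norm_num) h2 2
    have h5 := mul_le_mul_of_nonneg_left h4 hn
    linarith [hA.le_sum Y hY]
  have h4 : 0.99088 * √n ≤ ‖sensing A (Y + (U + V))‖ := by
    have h5 : ‖sensing A Y‖ ≤ ‖sensing A (Y + (U + V))‖ + ‖sensing A (U + V)‖ := by
      rw [sensing_add Y]
      simpa using norm_sub_le (sensing A Y + sensing A (U + V)) (sensing A (U + V))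
    linarith
  have h5 := pow_le_pow_left₀ (by positivity) h4 2
  rw [norm_sensing_sq, mul_pow, Real.sq_sqrt hn] at h5
  linarith

theorem softAbs_nonneg (T x : ℝ) : 0 ≤ softAbs T x := le_max_right _ _

theorem softAbs_add_le (T x y : ℝ) : softAbs T (x + y) ≤ softAbs T x + |y| := by
  refine max_le ?_ (add_nonneg (softAbs_nonneg _ _) (abs_nonneg _))
  have h1 : |x| - T ≤ softAbs T x := le_max_left _ _
  linarith [abs_add_le x y]

theorem sq_le_softAbs (T x : ℝ) : x ^ 2 ≤ 2 * softAbs T x ^ 2 + 2 * T ^ 2 := by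
  have h1 : |x| ≤ softAbs T x + T := by
    have : |x| - T ≤ softAbs T x := le_max_left _ _
    linarith
  have h2 : |x| ^ 2 ≤ (softAbs T x + T) ^ 2 := pow_le_pow_left₀ (abs_nonneg x) h1 2
  rw [sq_abs] at h2
  nlinarith [sq_nonneg (softAbs T x - T)]

/-- Soft thresholding is not homogeneous but is 1-Lipschitz, so the net bound moves to `X` at the
cost of the `ℓ²` norm of the error measurements. -/
theorem IsRegularOn.sum_softAbs_sq_le (hA : IsRegularOn A T N) (hN : IsRankNet k (1 / 1000) N)
    {X : Matrix (Fin d₁) (Fin d₂) ℝ} (hX : X.rank ≤ k) (hX1 : frobNorm X = 1) :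
    ∑ i, softAbs T (frobInner (A i) X) ^ 2 ≤ n / 300 := by
  obtain ⟨Y, hY, U, V, rfl, hU, hV, hUε, hVε⟩ := hN.exists_near X hX hX1.le
  have h1 := hA.norm_sensing_error_le hN hU hV hUε hVε
  have hn : (0 : ℝ) ≤ n := n.cast_nonneg
  let a : EuclideanSpace ℝ (Fin n) := WithLp.toLp 2 fun i => softAbs T (frobInner (A i) Y)
  let b : EuclideanSpace ℝ (Fin n) := WithLp.toLp 2 fun i => |frobInner (A i) (U + V)|
  have ha : ‖a‖ ≤ 0.05 * √n := by
    refine le_of_sq_le_sq ?_ (by positivity)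
    rw [EuclideanSpace.real_norm_sq_eq, mul_pow, Real.sq_sqrt hn]
    have := hA.soft_le Y hY
    simp only [a]
    linarith
  have hb : ‖b‖ ≤ 0.00202 * √n := by
    refine le_trans (le_of_sq_le_sq ?_ (norm_nonneg _)) h1
    rw [EuclideanSpace.real_norm_sq_eq, norm_sensing_sq]
    simp [b]
  have h2 := pow_le_pow_left₀ (norm_nonneg _) ((norm_add_le a b).trans (add_le_add ha hb)) 2
  rw [EuclideanSpace.real_norm_sq_eq, ← add_mul, mul_pow, Real.sq_sqrt hn] at h2
  calc ∑ i, softAbs T (frobInner (A i) (Y + (U + V))) ^ 2 ≤ ∑ i, (a + b).ofLp i ^ 2 := by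
        refine Finset.sum_le_sum fun i _ => pow_le_pow_left₀ (softAbs_nonneg _ _) ?_ 2
        rw [frobInner_add_right]
        exact softAbs_add_le _ _ _
    _ ≤ _ := h2
    _ ≤ n / 300 := by norm_num; linarith

/-- For `frobNorm X = 1` the indices in `J` carry at most `2n / 300 + 160 * 2.05n / 12000`, about
`0.034n`, which fits in the gap between `0.98` and `15 / 16`. -/
theorem IsRegularOn.le_sum_compl_sq (hA : IsRegularOn A T N) (hN : IsRankNet k (1 / 1000) N)
    (hT2 : T ^ 2 = 80) {X : Matrix (Fin d₁) (Fin d₂) ℝ} (hX : X.rank ≤ k)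
    {J : Finset (Fin n)} (hJ : (J.card : ℝ) * 12000 ≤ 2.05 * n) :
    15 / 16 * (n * frobNorm X ^ 2) ≤ ∑ i ∈ Jᶜ, frobInner (A i) X ^ 2 := by
  rcases (frobNorm_nonneg X).eq_or_lt with h0 | h0
  · rw [← h0]
    simp only [ne_eq, OfNat.ofNat_ne_zero, not_false_eq_true, zero_pow, mul_zero]
    positivity
  set c := frobNorm X with hc
  have hXe : X = c • (c⁻¹ • X) := by rw [smul_smul, mul_inv_cancel₀ h0.ne', one_smul]
  set Z := c⁻¹ • X with hZ
  have hZ1 : frobNorm Z = 1 := by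
    rw [hZ, frobNorm_smul, abs_of_pos (inv_pos.2 h0), inv_mul_cancel₀ h0.ne']
  have hZk : Z.rank ≤ k := by
    rwa [hZ, Matrix.rank_smul_of_mem_nonZeroDivisors _
      (mem_nonZeroDivisors_of_ne_zero (inv_ne_zero h0.ne'))]
  have h1 := hA.le_sum_sq hN hZk hZ1
  have h2 := hA.sum_softAbs_sq_le hN hZk hZ1
  have h3 : ∑ i ∈ J, frobInner (A i) Z ^ 2 ≤ 2 * (n / 300) + J.card * 160 := by
    calc ∑ i ∈ J, frobInner (A i) Z ^ 2
        ≤ ∑ i ∈ J, (2 * softAbs T (frobInner (A i) Z) ^ 2 + 2 * T ^ 2) :=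
          Finset.sum_le_sum fun i _ => sq_le_softAbs T _
      _ = 2 * ∑ i ∈ J, softAbs T (frobInner (A i) Z) ^ 2 + J.card * 160 := by
          rw [Finset.sum_add_distrib, Finset.mul_sum, hT2]
          simp
          norm_num
      _ ≤ 2 * ∑ i, softAbs T (frobInner (A i) Z) ^ 2 + J.card * 160 := by
          gcongr
          exact Finset.subset_univ J
      _ ≤ _ := by linarith
  have h4 := Finset.sum_add_sum_compl J fun i => frobInner (A i) Z ^ 2
  have hn : (0 : ℝ) ≤ n := n.cast_nonneg
  have h5 : 15 / 16 * n ≤ ∑ i ∈ Jᶜ, frobInner (A i) Z ^ 2 := by linarith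
  rw [hXe]
  simp_rw [frobInner_smul_right, mul_pow]
  rw [← Finset.mul_sum]
  have := mul_le_mul_of_nonneg_left h5 (sq_nonneg c)
  linarith

theorem rank_sub_le_two_mul {m : ℕ} {X Y : Matrix (Fin d₁) (Fin d₂) ℝ} (hX : X.rank ≤ m)
    (hY : Y.rank ≤ m) : (Y - X).rank ≤ 2 * m := by
  have h1 : (Y - X).mulVecLin.range ≤ Y.mulVecLin.range ⊔ X.mulVecLin.range := by
    rintro _ ⟨v, rfl⟩
    rw [Matrix.mulVecLin_apply, Matrix.sub_mulVec]
    exact Submodule.sub_mem _ (Submodule.mem_sup_left ⟨v, rfl⟩) (Submodule.mem_sup_right ⟨v, rfl⟩)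
  have h2 := (Submodule.finrank_mono h1).trans
    (Submodule.finrank_add_le_finrank_add_finrank Y.mulVecLin.range X.mulVecLin.range)
  change (Y - X).rank ≤ Y.rank + X.rank at h2
  omega

theorem frobNorm_sub_comm (X Y : Matrix (Fin d₁) (Fin d₂) ℝ) :
    frobNorm (X - Y) = frobNorm (Y - X) := by
  let _ : NormedAddCommGroup (Matrix (Fin d₁) (Fin d₂) ℝ) := Matrix.frobeniusNormedAddCommGroup
  exact norm_sub_rev X Y

theorem IsRegularOn.rsm_loss {m : ℕ} (hA : IsRegularOn A T N)
    (hN : IsRankNet (2 * m) (1 / 1000) N) (hn : 0 < n) {ψ : ℝ → ℝ} (hψ : ContDiff ℝ 2 ψ) {B : ℝ}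
    (hB0 : 0 ≤ B) (hB : ∀ x, iteratedDeriv 2 ψ x ≤ B) (y : Fin n → ℝ)
    (𝒞 : Set (Matrix (Fin d₁) (Fin d₂) ℝ)) : RSM (loss ψ A y) m (17 / 16 * B) 𝒞 := by
  intro X _ Y _ hX hY
  have hn' : (0 : ℝ) < n := Nat.cast_pos.2 hn
  rw [bregman_loss (hψ.differentiable (by norm_num)), frobNorm_sub_comm, one_div,
    inv_mul_le_iff₀ hn']
  calc ∑ i, (ψ (frobInner (A i) Y) - ψ (frobInner (A i) X) -
        deriv ψ (frobInner (A i) X) * (frobInner (A i) Y - frobInner (A i) X))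
      ≤ ∑ i, B / 2 * frobInner (A i) (Y - X) ^ 2 := by
        refine Finset.sum_le_sum fun i _ => ?_
        rw [frobInner_sub_right]
        exact sub_sub_deriv_mul_le_of_iteratedDeriv_le hψ hB _ _
    _ = B / 2 * ∑ i, frobInner (A i) (Y - X) ^ 2 := by rw [Finset.mul_sum]
    _ ≤ B / 2 * (1.0201 * n * frobNorm (Y - X) ^ 2) := by
        gcongr
        exact hA.sum_sq_le hN (rank_sub_le_two_mul hX hY)
    _ ≤ n * (17 / 16 * B / 2 * frobNorm (Y - X) ^ 2) := by
        have : 0 ≤ B * n * frobNorm (Y - X) ^ 2 := by positivity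
        linarith

theorem IsRegularOn.rsc_loss {m : ℕ} (hA : IsRegularOn A T N)
    (hN : IsRankNet (2 * m) (1 / 1000) N) (hn : 0 < n) (hT2 : T ^ 2 = 80)
    {ψ : ℝ → ℝ} (hψ : ContDiff ℝ 2 ψ) (hc : ConvexOn ℝ Set.univ ψ) {b M ρ : ℝ} (hb0 : 0 ≤ b)
    (hρ : 0 < ρ) (hM : 0 ≤ M) (hMρ : M ^ 2 = 12000 * ρ ^ 2)
    (hb : ∀ x, |x| ≤ M → b ≤ iteratedDeriv 2 ψ x)
    (y : Fin n → ℝ) : RSC (loss ψ A y) m (15 / 16 * b) (frobBall d₁ d₂ ρ) := by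
  classical
  intro X hXρ Y hYρ hX hY
  have hn' : (0 : ℝ) < n := Nat.cast_pos.2 hn
  rw [bregman_loss (hψ.differentiable (by norm_num)), frobNorm_sub_comm, one_div,
    le_inv_mul_iff₀ hn']
  -- Indices where the lower curvature bound may fail. Each contributes at least `M ^ 2` to the two
  -- quadratic sums, which bounds their number.
  set J : Finset (Fin n) :=
    Finset.univ.filter fun i => ¬(|frobInner (A i) X| ≤ M ∧ |frobInner (A i) Y| ≤ M) with hJdef
  have hsum : ∀ {Z : Matrix (Fin d₁) (Fin d₂) ℝ}, Z ∈ frobBall d₁ d₂ ρ → Z.rank ≤ m →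
      ∑ i, frobInner (A i) Z ^ 2 ≤ 1.0201 * n * ρ ^ 2 := fun {Z} hZρ hZ => by
    refine (hA.sum_sq_le hN (by omega)).trans ?_
    have := pow_le_pow_left₀ (frobNorm_nonneg Z) hZρ 2
    gcongr
  have hJ : (J.card : ℝ) * 12000 ≤ 2.05 * n := by
    have h1 : (J.card : ℝ) * M ^ 2 ≤ ∑ i, (frobInner (A i) X ^ 2 + frobInner (A i) Y ^ 2) := by
      calc (J.card : ℝ) * M ^ 2 = ∑ _i ∈ J, M ^ 2 := by simp
        _ ≤ ∑ i ∈ J, (frobInner (A i) X ^ 2 + frobInner (A i) Y ^ 2) := by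
            refine Finset.sum_le_sum fun i hi => ?_
            have hi' := (Finset.mem_filter.1 hi).2
            have hx := sq_nonneg (frobInner (A i) X)
            have hy := sq_nonneg (frobInner (A i) Y)
            rw [not_and_or, not_le, not_le] at hi'
            rcases hi' with h | h
            · have := pow_le_pow_left₀ hM h.le 2
              rw [sq_abs] at this
              linarith
            · have := pow_le_pow_left₀ hM h.le 2
              rw [sq_abs] at this
              linarith
        _ ≤ _ := Finset.sum_le_sum_of_subset_of_nonneg (Finset.subset_univ J)
            fun i _ _ => by positivity
    rw [Finset.sum_add_distrib, hMρ] at h1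
    have h2 := hsum hXρ hX
    have h3 := hsum hYρ hY
    have hρ2 : 0 < ρ ^ 2 := by positivity
    refine le_of_mul_le_mul_right ?_ hρ2
    have : 0 ≤ n * ρ ^ 2 := by positivity
    linarith
  have h1 := hA.le_sum_compl_sq hN hT2 (rank_sub_le_two_mul hX hY) hJ
  calc n * (15 / 16 * b / 2 * frobNorm (Y - X) ^ 2)
      = b / 2 * (15 / 16 * (n * frobNorm (Y - X) ^ 2)) := by ring
    _ ≤ b / 2 * ∑ i ∈ Jᶜ, frobInner (A i) (Y - X) ^ 2 := by gcongr
    _ = ∑ i ∈ Jᶜ, b / 2 * frobInner (A i) (Y - X) ^ 2 := by rw [Finset.mul_sum]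
    _ ≤ ∑ i ∈ Jᶜ, (ψ (frobInner (A i) Y) - ψ (frobInner (A i) X) -
        deriv ψ (frobInner (A i) X) * (frobInner (A i) Y - frobInner (A i) X)) := by
        refine Finset.sum_le_sum fun i hi => ?_
        have hi' : |frobInner (A i) X| ≤ M ∧ |frobInner (A i) Y| ≤ M := by
          by_contra hcon
          exact (Finset.mem_compl.1 hi) (Finset.mem_filter.2 ⟨Finset.mem_univ _, hcon⟩)
        rw [frobInner_sub_right]
        refine le_sub_sub_deriv_mul_of_le_iteratedDeriv hψ (convex_Icc (-M) M)
          (fun x hx => hb x (abs_le.2 hx)) (abs_le.1 hi'.1) (abs_le.1 hi'.2)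
    -- Convexity of `ψ` alone makes the terms in `J` nonnegative.
    _ ≤ _ := Finset.sum_le_sum_of_subset_of_nonneg (Finset.subset_univ _)
        fun i _ _ => tangent_le hψ hc _ _

theorem opNorm_le_of_net {M : Matrix (Fin d₁) (Fin d₂) ℝ} (hN : IsRankNet 1 (1 / 1000) N) {b : ℝ}
    (hb : 0 ≤ b) (h : ∀ Y ∈ N, |frobInner M Y| ≤ b) : opNorm M ≤ b / (1 - 2 * (1 / 1000)) := by
  refine opNorm_le_of_frobInner_le (div_nonneg hb (by norm_num)) fun X hX => ?_
  refine (le_abs_self _).trans ?_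
  exact hN.le_of_forall_le (by norm_num) (p := fun X => |frobInner M X|)
    (fun X Y => by rw [frobInner_add_right]; exact abs_add_le _ _)
    (fun c X => by rw [frobInner_smul_right, abs_mul]) (abs_frobInner_le M) h X hX

end RestrictedIsometry

/-! ### Tail bounds at a fixed matrix and the union bound. -/

section Concentration

variable {Ω : Type*} [MeasurableSpace Ω] {P : Measure Ω} {d₁ d₂ n : ℕ} {ν : Measure ℝ} [SFinite ν]
  {ψ : ℝ → ℝ} {s : ℝ} {Xs : Matrix (Fin d₁) (Fin d₂) ℝ}
  {A : Fin n → Ω → Matrix (Fin d₁) (Fin d₂) ℝ} {y : Fin n → Ω → ℝ}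

/-- The Chernoff bound for a sum of a function of the measurements of a fixed matrix. -/
theorem IsGaussianModel.measure_le_sum_frobInner_le (hψ : IsLogPartition ν ψ s)
    (h : IsGaussianModel P ν ψ s Xs A y) {Y : Matrix (Fin d₁) (Fin d₂) ℝ} {g : ℝ → ℝ}
    (hg : Measurable g) {b : ℝ}
    (hb : ∫⁻ x, ENNReal.ofReal (Real.exp (g x)) ∂(gaussianReal 0 (frobVar Y)) ≤
      ENNReal.ofReal (Real.exp b)) (t : ℝ) :
    P {ω | t ≤ ∑ i, g (frobInner (A i ω) Y)} ≤ ENNReal.ofReal (Real.exp (n * b - t)) := by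
  have := isProbabilityMeasure_pairLaw hψ Xs
  refine measure_le_sum_le h.indep h.law (g := fun p => g (frobInner p.1 Y))
    (hg.comp ((measurable_frobInner_left Y).comp measurable_fst)) ?_ t
  rw [lintegral_pairLaw_frobInner hψ Xs Y (f := fun x => ENNReal.ofReal (Real.exp (g x)))
    (by fun_prop)]
  exact hb

theorem frobVar_le_one {Y : Matrix (Fin d₁) (Fin d₂) ℝ} (hY : frobNorm Y ≤ 1) : frobVar Y ≤ 1 :=
  pow_le_one₀ (frobNorm_nonneg Y) hY

theorem IsGaussianModel.measure_sum_sq_ge_le (hψ : IsLogPartition ν ψ s)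
    (h : IsGaussianModel P ν ψ s Xs A y) {Y : Matrix (Fin d₁) (Fin d₂) ℝ} (hY : frobNorm Y ≤ 1) :
    P {ω | n * (1 + 1 / 100) ≤ ∑ i, frobInner (A i ω) Y ^ 2} ≤
      ENNReal.ofReal (Real.exp (-(n / 160000))) := by
  -- `t = 1 / 800` minimizes `4 * t ^ 2 - t / 100`, with minimum `-1 / 160000`.
  have hb := lintegral_exp_mul_sq_le (frobVar_le_one hY) (t := 1 / 800)
    (by rw [abs_of_pos] <;> norm_num)
  have h1 := h.measure_le_sum_frobInner_le hψ (by fun_prop) hb (1 / 800 * (n * (1 + 1 / 100)))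
  refine (measure_mono fun ω hω => ?_).trans (h1.trans (ENNReal.ofReal_le_ofReal
    (Real.exp_le_exp.2 ?_)))
  · simp only [Set.mem_ofPred_eq] at hω ⊢
    rw [← Finset.mul_sum]
    exact mul_le_mul_of_nonneg_left hω (by norm_num)
  · have h2 : (frobVar Y : ℝ) ≤ 1 := frobVar_le_one hY
    have h3 : (n : ℝ) * frobVar Y ≤ n * 1 := mul_le_mul_of_nonneg_left h2 n.cast_nonneg
    linarith

theorem IsGaussianModel.measure_sum_sq_le_le (hψ : IsLogPartition ν ψ s)
    (h : IsGaussianModel P ν ψ s Xs A y) {Y : Matrix (Fin d₁) (Fin d₂) ℝ} (hY : frobNorm Y ≤ 1) :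
    P {ω | ∑ i, frobInner (A i ω) Y ^ 2 ≤ n * (frobNorm Y ^ 2 - 1 / 100)} ≤
      ENNReal.ofReal (Real.exp (-(n / 160000))) := by
  have hb := lintegral_exp_mul_sq_le (frobVar_le_one hY) (t := -(1 / 800))
    (by rw [abs_neg, abs_of_pos] <;> norm_num)
  have h1 := h.measure_le_sum_frobInner_le hψ (by fun_prop) hb
    (-(1 / 800) * (n * (frobNorm Y ^ 2 - 1 / 100)))
  refine (measure_mono fun ω hω => ?_).trans (h1.trans (ENNReal.ofReal_le_ofReal
    (Real.exp_le_exp.2 ?_)))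
  · simp only [Set.mem_ofPred_eq] at hω ⊢
    rw [← Finset.mul_sum]
    linarith
  · have h2 : (frobVar Y : ℝ) = frobNorm Y ^ 2 := rfl
    rw [h2]
    have : (0 : ℝ) ≤ n := n.cast_nonneg
    linarith

theorem IsGaussianModel.measure_sum_softAbs_sq_ge_le (hψ : IsLogPartition ν ψ s)
    (h : IsGaussianModel P ν ψ s Xs A y) {T : ℝ} (hT : 0 ≤ T) (hT2 : T ^ 2 = 80)
    {Y : Matrix (Fin d₁) (Fin d₂) ℝ} (hY : frobNorm Y ≤ 1) :
    P {ω | (n : ℝ) / 400 ≤ ∑ i, softAbs T (frobInner (A i ω) Y) ^ 2} ≤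
      ENNReal.ofReal (Real.exp (-(n / 160000))) := by
  have hb := lintegral_exp_softAbs_sq_le (frobVar_le_one hY) hT
  have := measurable_softAbs T
  have h1 := h.measure_le_sum_frobInner_le hψ (by fun_prop) hb (1 / 8 * (n / 400))
  refine (measure_mono fun ω hω => ?_).trans (h1.trans (ENNReal.ofReal_le_ofReal
    (Real.exp_le_exp.2 ?_)))
  · simp only [Set.mem_ofPred_eq] at hω ⊢
    rw [← Finset.mul_sum]
    exact mul_le_mul_of_nonneg_left hω (by norm_num)
  -- With `T ^ 2 = 80` this is `exp (-10)`; twice it must stay below the threshold rate `1 / 3200`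
  -- by at least `1 / 160000`.
  · have h2 : Real.exp (-(T ^ 2 / 8)) ≤ 1 / 16384 := by
      have h3 : Real.exp (T ^ 2 / 8) = Real.exp 1 ^ 10 := by
        rw [← Real.exp_nat_mul, hT2]; norm_num
      have h4 := Real.exp_one_gt_d9
      rw [Real.exp_neg, h3, ← one_div]
      refine one_div_le_one_div_of_le (by norm_num) ?_
      calc (16384 : ℝ) ≤ 2.7 ^ 10 := by norm_num
        _ ≤ Real.exp 1 ^ 10 := pow_le_pow_left₀ (by norm_num) (by linarith) 10
    have h3 := mul_le_mul_of_nonneg_left h2 (n.cast_nonneg (α := ℝ))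
    have : (0 : ℝ) ≤ n := n.cast_nonneg
    linarith

theorem IsGaussianModel.measure_sum_score_ge_le (hs : 0 < s) (hψ : IsLogPartition ν ψ s)
    (h : IsGaussianModel P ν ψ s Xs A y) {B : ℝ} (hB0 : 0 < B)
    (hB : ∀ x, iteratedDeriv 2 ψ x ≤ B) {d : ℕ} (hd : 0 < d) (hdn : d ≤ n) {σ : ℝ} (hσ : σ ^ 2 = 1)
    {Y : Matrix (Fin d₁) (Fin d₂) ℝ} (hY : frobNorm Y ≤ 1) :
    P {ω | 30 * √(s * B) * √(d * n) ≤ σ * ∑ i, (deriv ψ (frobInner (A i ω) Xs) - y i ω) *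
      frobInner (A i ω) Y} ≤ ENNReal.ofReal (Real.exp (-(19 * d))) := by
  have := isProbabilityMeasure_pairLaw hψ Xs
  have hd' : (0 : ℝ) < d := Nat.cast_pos.2 hd
  have hn' : (0 : ℝ) < n := Nat.cast_pos.2 (hd.trans_le hdn)
  have hdn' : (d : ℝ) ≤ n := Nat.cast_le.2 hdn
  -- This choice makes `q = d / (2 * n)`, at most `1 / 2` as `d ≤ n`. The Chernoff exponent is then
  -- at most `d / 2 - 30 * 0.7 * d`. The sign `σ` covers both tails.
  set u : ℝ := √(d / (2 * n * (s * B))) with hu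
  have hsB : 0 < s * B := mul_pos hs hB0
  have hu2 : u ^ 2 = d / (2 * n * (s * B)) := Real.sq_sqrt (by positivity)
  have hq : s * B * (u * σ) ^ 2 = d / (2 * n) := by
    rw [mul_pow, hσ, hu2]
    field_simp
  have hb := lintegral_pairLaw_exp_score_le (ν := ν) hs hψ hB0.le hB Xs Y hY hq (by
    rw [div_le_div_iff₀ (by positivity) (by norm_num)]; linarith)
  have hm1 : Measurable fun p : Matrix (Fin d₁) (Fin d₂) ℝ × ℝ => frobInner p.1 Xs :=
    (measurable_frobInner_left Xs).comp measurable_fst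
  have hm2 : Measurable fun p : Matrix (Fin d₁) (Fin d₂) ℝ × ℝ => frobInner p.1 Y :=
    (measurable_frobInner_left Y).comp measurable_fst
  have hm3 : Measurable (deriv ψ) := measurable_deriv ψ
  have h1 := measure_le_sum_le h.indep h.law (by fun_prop) hb
    (u * (30 * √(s * B) * √(d * n)))
  refine (measure_mono fun ω hω => ?_).trans (h1.trans (ENNReal.ofReal_le_ofReal
    (Real.exp_le_exp.2 ?_)))
  · simp only [Set.mem_ofPred_eq] at hω ⊢
    rw [← Finset.mul_sum, mul_assoc u σ]
    exact mul_le_mul_of_nonneg_left hω (Real.sqrt_nonneg _)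
  · have h2 : 0.7 * d ≤ u * (√(s * B) * √(d * n)) := by
      refine le_of_sq_le_sq ?_ (by positivity)
      rw [mul_pow, mul_pow, mul_pow, hu2, Real.sq_sqrt hsB.le, Real.sq_sqrt (by positivity)]
      have h3 : (d : ℝ) / (2 * n * (s * B)) * (s * B * (d * n)) = 1 / 2 * d ^ 2 := by
        field_simp
      rw [h3]
      have := sq_nonneg (d : ℝ)
      norm_num
      linarith
    have h3 : (n : ℝ) * (d / (2 * n)) = d / 2 := by field_simp
    rw [h3]
    linarith

/-- The net has at most `2001 ^ (2 * k * d) ≤ exp (16 * k * d)` points, so the rate `19` leaves `3`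
after the union bound. -/
theorem measure_exists_mem_net_le {k d : ℕ} (hk : 1 ≤ k) {N : Finset (Matrix (Fin d₁) (Fin d₂) ℝ)}
    (hN : (N.card : ℝ) ≤ (1 + 2 / (1 / 1000)) ^ (2 * k * d))
    {bad : Matrix (Fin d₁) (Fin d₂) ℝ → Set Ω}
    (hbad : ∀ Y ∈ N, P (bad Y) ≤ ENNReal.ofReal (Real.exp (-(19 * (k * d))))) :
    P (⋃ Y ∈ N, bad Y) ≤ ENNReal.ofReal (Real.exp (-(3 * d))) := by
  calc P (⋃ Y ∈ N, bad Y) ≤ ∑ Y ∈ N, P (bad Y) := measure_biUnion_finset_le _ _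
    _ ≤ ∑ _Y ∈ N, ENNReal.ofReal (Real.exp (-(19 * (k * d)))) := Finset.sum_le_sum hbad
    _ = ENNReal.ofReal (N.card * Real.exp (-(19 * (k * d)))) := by
        rw [Finset.sum_const, nsmul_eq_mul, ENNReal.ofReal_mul (Nat.cast_nonneg _),
          ENNReal.ofReal_natCast]
    _ ≤ _ := by
        refine ENNReal.ofReal_le_ofReal ?_
        have h1 : (1 + 2 / (1 / 1000) : ℝ) ≤ Real.exp 8 := by
          have h2 : Real.exp 8 = Real.exp 1 ^ 8 := by rw [← Real.exp_nat_mul]; norm_num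
          rw [h2]
          calc (1 + 2 / (1 / 1000) : ℝ) ≤ 2.7 ^ 8 := by norm_num
            _ ≤ Real.exp 1 ^ 8 :=
              pow_le_pow_left₀ (by norm_num) (by linarith [Real.exp_one_gt_d9]) 8
        have h2 : (N.card : ℝ) ≤ Real.exp (16 * (k * d)) := by
          refine (hN.trans (pow_le_pow_left₀ (by norm_num) h1 _)).trans (le_of_eq ?_)
          rw [← Real.exp_nat_mul]
          push_cast
          ring_nf
        refine (mul_le_mul_of_nonneg_right h2 (Real.exp_pos _).le).trans ?_
        rw [← Real.exp_add]
        refine Real.exp_le_exp.2 ?_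
        have h3 : (d : ℝ) ≤ k * d :=
          le_mul_of_one_le_left d.cast_nonneg (by exact_mod_cast hk)
        linarith

end Concentration

/-! ### Numerical bookkeeping and the final assembly. -/

section Main

/-- The term linear in `κ` is absorbed through `κ ≤ κ * log κ + 1`, a consequence of `log κ ≥ 1 - 1
/ κ`. -/
theorem rank_budget_le {κ : ℝ} (hκ : 1 ≤ κ) :
    (⌈4 * κ * (Real.log (4 * κ) + 1)⌉₊ : ℝ) ≤ 15 * ((⌈κ * Real.log κ⌉₊ : ℝ) + 1) := by
  have hκ0 : 0 < κ := by linarith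
  have hlogκ := Real.log_nonneg hκ
  have h4 : Real.log 4 ≤ 1.4 := by
    have h1 : Real.log 4 = 2 * Real.log 2 := by
      rw [show (4 : ℝ) = 2 ^ 2 by norm_num, Real.log_pow]
      norm_num
    linarith [Real.log_two_lt_d9]
  have hlog4κ : Real.log (4 * κ) = Real.log 4 + Real.log κ :=
    Real.log_mul (by norm_num) hκ0.ne'
  have hlog4 : 0 ≤ Real.log 4 := Real.log_nonneg (by norm_num)
  have h1 := (Nat.ceil_lt_add_one (a := 4 * κ * (Real.log (4 * κ) + 1)) (by
    rw [hlog4κ]; positivity)).le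
  have h2 := Nat.le_ceil (κ * Real.log κ)
  have h3 : κ ≤ κ * Real.log κ + 1 := by
    have h := mul_le_mul_of_nonneg_left (Real.one_sub_inv_le_log_of_pos hκ0) hκ0.le
    rw [mul_sub, mul_one, mul_inv_cancel₀ hκ0.ne'] at h
    linarith
  have h5 := mul_le_mul_of_nonneg_left h4 hκ0.le
  rw [hlog4κ] at h1 ⊢
  linarith

theorem five_mul_exp_le {d : ℕ} (hd : 0 < d) :
    5 * Real.exp (-(3 * d)) ≤ Real.exp (-1 * d) := by
  have hd' : (1 : ℝ) ≤ d := Nat.one_le_cast.2 hd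
  have h1 : Real.exp (-(3 * d)) = Real.exp (-1 * d) * Real.exp (-(2 * d)) := by
    rw [← Real.exp_add]; ring_nf
  have h2 : Real.exp (-(2 * d)) ≤ 1 / 5 := by
    have h3 : Real.exp 2 = Real.exp 1 ^ 2 := by rw [← Real.exp_nat_mul]; norm_num
    have h4 : 5 ≤ Real.exp 2 := by
      rw [h3]
      nlinarith [Real.exp_one_gt_d9]
    rw [Real.exp_neg, ← one_div]
    exact one_div_le_one_div_of_le (by norm_num)
      (h4.trans (Real.exp_le_exp.2 (by linarith)))
  rw [h1]
  nlinarith [Real.exp_pos (-1 * d : ℝ)]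

theorem opNorm_grad_loss_le {d₁ d₂ n d : ℕ} {ψ : ℝ → ℝ} (hψ : Differentiable ℝ ψ)
    {A : Fin n → Matrix (Fin d₁) (Fin d₂) ℝ} {y : Fin n → ℝ} {Xs : Matrix (Fin d₁) (Fin d₂) ℝ}
    {N : Finset (Matrix (Fin d₁) (Fin d₂) ℝ)} (hN : IsRankNet 1 (1 / 1000) N) (hn : 0 < n) {b : ℝ}
    (hb : 0 ≤ b) (h : ∀ Y ∈ N, |∑ i, (deriv ψ (frobInner (A i) Xs) - y i) * frobInner (A i) Y| ≤
      30 * b * √(d * n)) :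
    opNorm (grad (loss ψ A y) Xs) ≤ 31 * b * √(d / n) := by
  have hn' : (0 : ℝ) < n := Nat.cast_pos.2 hn
  have h1 : √(d * n : ℝ) = n * √(d / n) := by
    rw [← Real.sqrt_sq hn'.le, ← Real.sqrt_mul (by positivity), Real.sqrt_sq hn'.le]
    congr 1
    field_simp
  have hpos : 0 ≤ b * √(d / n : ℝ) := by positivity
  refine (opNorm_le_of_net hN (b := 30 * b * √(d / n)) (by positivity) fun Y hY => ?_).trans ?_
  · rw [frobInner_grad_loss hψ, abs_mul, abs_of_nonneg (by positivity), one_div,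
      inv_mul_le_iff₀ hn']
    refine (h Y hY).trans (le_of_eq ?_)
    rw [h1]
    ring
  · rw [div_le_iff₀ (by norm_num)]
    linarith

end Main

end RGLM

theorem mainTheorem6 :
    ∃ c C c₀ c₁ : ℝ, 0 < c ∧ 0 < C ∧ 0 < c₀ ∧ 0 < c₁ ∧
      ∀ (Ω : Type*) [MeasurableSpace Ω] (P : MeasureTheory.Measure Ω)
        [MeasureTheory.IsProbabilityMeasure P]
        (d₁ d₂ n : ℕ)
        (ν : MeasureTheory.Measure ℝ) [MeasureTheory.SigmaFinite ν] (ψ : ℝ → ℝ) (s : ℝ)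
        (Xstar : Matrix (Fin d₁) (Fin d₂) ℝ)
        (A : Fin n → Ω → Matrix (Fin d₁) (Fin d₂) ℝ) (y : Fin n → Ω → ℝ)
        (τ κ Bup Blow : ℝ) (d r t₀ : ℕ),
        0 < s →
        RGLM.IsLogPartition ν ψ s →
        RGLM.IsGaussianModel P ν ψ s Xstar A y →
        1 ≤ τ →
        d = max d₁ d₂ →
        r = Xstar.rank →
        1 ≤ r →
        BddAbove (Set.range fun x : ℝ => |iteratedDeriv 2 ψ x|) →
        Bup = RGLM.Bupper ψ →
        Blow = RGLM.Blower ψ (Real.sqrt (2.4 / c₀) * τ * RGLM.frobNorm Xstar) →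
        0 < Blow →
        κ = 1.1 * Bup / Blow →
        t₀ = ⌈4 * κ * (Real.log (4 * κ) + 1)⌉₊ →
        c * ((⌈κ * Real.log κ⌉₊ : ℝ) + 1) * r * d ≤ n →
        1 - Real.exp (-c₁ * d) ≤
          P.real {ω |
            let L := RGLM.loss ψ (fun i => A i ω) (fun i => y i ω)
            let 𝒞 := RGLM.frobBall d₁ d₂ (τ * RGLM.frobNorm Xstar)
            RGLM.RSC L (t₀ * r) (15 / 16 * Blow) 𝒞 ∧
            RGLM.RSM L (t₀ * r) (17 / 16 * Bup) 𝒞 ∧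
            RGLM.opNorm (RGLM.grad L Xstar) ≤ C * Real.sqrt (s * Bup) * Real.sqrt (d / n)} := by
  -- `c` exceeds `19 * 2 * 15 * 160000`; `C = 31` exceeds `30 / 0.998`; `c₀` gives `2.4 / c₀ =
  -- 12000`, the ratio `M ^ 2 / ρ ^ 2` in `rsc_loss`.
  refine ⟨100000000, 31, 1 / 5000, 1, by norm_num, by norm_num, by norm_num, by norm_num, ?_⟩
  intro Ω _ P _ d₁ d₂ n ν _ ψ s Xstar A y τ κ Bup Blow d r t₀ hs hψ hmodel hτ hd hr hr1 hbdd hBup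
    hBlow hBlow0 hκ ht₀ hn
  have hM0 : 0 ≤ √(2.4 / (1 / 5000)) * τ * RGLM.frobNorm Xstar :=
    mul_nonneg (by positivity) (RGLM.frobNorm_nonneg _)
  have hB : ∀ x, iteratedDeriv 2 ψ x ≤ Bup := fun x =>
    hBup ▸ (le_abs_self _).trans (RGLM.abs_iteratedDeriv_le_Bupper hbdd x)
  have hb : ∀ x, |x| ≤ √(2.4 / (1 / 5000)) * τ * RGLM.frobNorm Xstar →
      Blow ≤ iteratedDeriv 2 ψ x := fun x hx => hBlow ▸ RGLM.Blower_le hbdd hx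
  have hBB : Blow ≤ Bup := (hb 0 (by rwa [abs_zero])).trans (hB 0)
  have hBup0 : 0 < Bup := hBlow0.trans_le hBB
  have hκ1 : 1 ≤ κ := by
    rw [hκ, le_div_iff₀ hBlow0]
    linarith
  have hX : 0 < RGLM.frobNorm Xstar := by
    refine (RGLM.frobNorm_nonneg _).lt_of_ne fun h => ?_
    rw [RGLM.frobNorm_eq_zero.1 h.symm, Matrix.rank_zero] at hr
    omega
  have hd0 : 0 < d := by
    have : r ≤ d₁ := hr ▸ (Matrix.rank_le_height Xstar)
    have := le_max_left d₁ d₂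
    omega
  have ht₀1 : 1 ≤ t₀ := by
    rw [ht₀, Nat.one_le_ceil_iff]
    have := Real.log_nonneg (show 1 ≤ 4 * κ by linarith)
    positivity
  -- Differences of two matrices of rank at most `t₀ * r` have rank at most `k`.
  set k := 2 * (t₀ * r) with hk
  have hk1 : 1 ≤ k := by
    have := Nat.mul_le_mul ht₀1 hr1
    omega
  have hkn : 19 * ((k : ℝ) * d) ≤ n / 160000 := by
    have h1 := RGLM.rank_budget_le hκ1
    rw [← ht₀] at h1
    have h2 : (k : ℝ) * d = 2 * (t₀ * (r * d)) := by rw [hk]; push_cast; ring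
    have h3 : (0 : ℝ) ≤ r * d := by positivity
    have h4 := mul_le_mul_of_nonneg_right h1 h3
    have h5 : 0 ≤ ((⌈κ * Real.log κ⌉₊ : ℝ) + 1) * (r * d) := by positivity
    rw [h2]
    linarith
  have hdn : d ≤ n := by
    have h1 : (d : ℝ) ≤ k * d := le_mul_of_one_le_left d.cast_nonneg (by exact_mod_cast hk1)
    have h2 : (d : ℝ) ≤ n := by linarith [n.cast_nonneg (α := ℝ)]
    exact_mod_cast h2
  have hn0 : 0 < n := hd0.trans_le hdn
  obtain ⟨N, hN, hNc⟩ := RGLM.exists_isRankNet d₁ d₂ k (ε := 1 / 1000) (by norm_num)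
  obtain ⟨N₁, hN₁, hN₁c⟩ := RGLM.exists_isRankNet d₁ d₂ 1 (ε := 1 / 1000) (by norm_num)
  rw [← hd] at hNc hN₁c
  have hexp : ENNReal.ofReal (Real.exp (-(n / 160000))) ≤
      ENNReal.ofReal (Real.exp (-(19 * (k * d)))) :=
    ENNReal.ofReal_le_ofReal (Real.exp_le_exp.2 (by linarith))
  have hT2 : √(80 : ℝ) ^ 2 = 80 := Real.sq_sqrt (by norm_num)
  have p1 := RGLM.measure_exists_mem_net_le (P := P) hk1 hNc fun Y hY =>
    (hmodel.measure_sum_sq_ge_le hψ (hN.frobNorm_le Y hY)).trans hexp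
  have p2 := RGLM.measure_exists_mem_net_le (P := P) hk1 hNc fun Y hY =>
    (hmodel.measure_sum_sq_le_le hψ (hN.frobNorm_le Y hY)).trans hexp
  have p3 := RGLM.measure_exists_mem_net_le (P := P) hk1 hNc fun Y hY =>
    (hmodel.measure_sum_softAbs_sq_ge_le hψ (Real.sqrt_nonneg 80) hT2
      (hN.frobNorm_le Y hY)).trans hexp
  have p4 := RGLM.measure_exists_mem_net_le (P := P) le_rfl hN₁c fun Y hY => by
    simpa only [Nat.cast_one, one_mul] using hmodel.measure_sum_score_ge_le hs hψ hBup0 hB hd0 hdn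
      (σ := 1) (by norm_num) (hN₁.frobNorm_le Y hY)
  have p5 := RGLM.measure_exists_mem_net_le (P := P) le_rfl hN₁c fun Y hY => by
    simpa only [Nat.cast_one, one_mul] using hmodel.measure_sum_score_ge_le hs hψ hBup0 hB hd0 hdn
      (σ := -1) (by norm_num) (hN₁.frobNorm_le Y hY)
  set good := {ω |
    let L := RGLM.loss ψ (fun i => A i ω) (fun i => y i ω)
    let 𝒞 := RGLM.frobBall d₁ d₂ (τ * RGLM.frobNorm Xstar)
    RGLM.RSC L (t₀ * r) (15 / 16 * Blow) 𝒞 ∧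
    RGLM.RSM L (t₀ * r) (17 / 16 * Bup) 𝒞 ∧
    RGLM.opNorm (RGLM.grad L Xstar) ≤ 31 * Real.sqrt (s * Bup) * Real.sqrt (d / n)} with hgood
  -- Covering the whole space and using subadditivity avoids any need for `good`, a condition on
  -- uncountably many pairs, to be measurable.
  have hcover : Set.univ ⊆ good ∪
      ((⋃ Y ∈ N, {ω | n * (1 + 1 / 100) ≤ ∑ i, RGLM.frobInner (A i ω) Y ^ 2}) ∪
      ((⋃ Y ∈ N, {ω | ∑ i, RGLM.frobInner (A i ω) Y ^ 2 ≤
        n * (RGLM.frobNorm Y ^ 2 - 1 / 100)}) ∪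
      ((⋃ Y ∈ N, {ω | (n : ℝ) / 400 ≤ ∑ i, RGLM.softAbs √80 (RGLM.frobInner (A i ω) Y) ^ 2}) ∪
      ((⋃ Y ∈ N₁, {ω | 30 * √(s * Bup) * √(d * n) ≤
        ∑ i, (deriv ψ (RGLM.frobInner (A i ω) Xstar) - y i ω) * RGLM.frobInner (A i ω) Y}) ∪
      (⋃ Y ∈ N₁, {ω | 30 * √(s * Bup) * √(d * n) ≤
        -1 * ∑ i, (deriv ψ (RGLM.frobInner (A i ω) Xstar) - y i ω) *
          RGLM.frobInner (A i ω) Y}))))) := by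
    intro ω _
    by_contra hω
    simp only [Set.mem_union, not_or, Set.mem_iUnion, Set.mem_ofPred_eq, not_exists, not_le] at hω
    obtain ⟨hω, h1, h2, h3, h4, h5⟩ := hω
    have hreg : RGLM.IsRegularOn (fun i => A i ω) √80 N :=
      ⟨fun Y hY => (h1 Y hY).le, fun Y hY => (h2 Y hY).le, fun Y hY => (h3 Y hY).le⟩
    refine hω ⟨?_, ?_, ?_⟩
    · refine hreg.rsc_loss hN hn0 hT2 hψ.contDiff hψ.convexOn hBlow0.le
        (mul_pos (by linarith) hX) hM0 ?_ hb _
      rw [mul_assoc, mul_pow, Real.sq_sqrt (by norm_num)]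
      norm_num
    · exact hreg.rsm_loss hN hn0 hψ.contDiff hBup0.le hB _ _
    · refine RGLM.opNorm_grad_loss_le (hψ.contDiff.differentiable (by norm_num)) hN₁ hn0
        (Real.sqrt_nonneg _) fun Y hY => ?_
      rw [abs_le]
      have h4' := h4 Y hY
      have h5' := h5 Y hY
      constructor <;> linarith
  have hP : (1 : ENNReal) ≤ P good + ENNReal.ofReal (Real.exp (-1 * d)) := by
    calc (1 : ENNReal) = P Set.univ := measure_univ.symm
      _ ≤ _ := measure_mono hcover
      _ ≤ P good + (ENNReal.ofReal (Real.exp (-(3 * d))) + (ENNReal.ofReal (Real.exp (-(3 * d))) +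
          (ENNReal.ofReal (Real.exp (-(3 * d))) + (ENNReal.ofReal (Real.exp (-(3 * d))) +
          ENNReal.ofReal (Real.exp (-(3 * d))))))) := by
        refine (measure_union_le _ _).trans (add_le_add le_rfl ?_)
        refine (measure_union_le _ _).trans (add_le_add p1 ?_)
        refine (measure_union_le _ _).trans (add_le_add p2 ?_)
        refine (measure_union_le _ _).trans (add_le_add p3 ?_)
        exact (measure_union_le _ _).trans (add_le_add p4 p5)
      _ ≤ _ := by
        have h1 := (Real.exp_pos (-(3 * d : ℝ))).le
        refine add_le_add le_rfl ?_
        rw [← ENNReal.ofReal_add h1 h1, ← ENNReal.ofReal_add h1 (by positivity),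
          ← ENNReal.ofReal_add h1 (by positivity), ← ENNReal.ofReal_add h1 (by positivity)]
        refine ENNReal.ofReal_le_ofReal ?_
        linarith [RGLM.five_mul_exp_le hd0]
  have h2 := ENNReal.toReal_mono (by finiteness) hP
  rw [ENNReal.toReal_one, ENNReal.toReal_add (by finiteness) (by finiteness),
    ENNReal.toReal_ofReal (Real.exp_pos _).le] at h2
  rw [Measure.real]
  linarith
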